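/- Let $q\ge 2$ and $d\ge 1$ be integers, let $A_0,\dots,A_{q-1}\in\mathbb{C}^{d\times d}$ and $C=\sum_{0\le r<q}A_r$. Let $f\colon\mathbb{Z}_{\ge 0}\to\mathbb{C}^{d\times d}$ be the sequence with $f(0)=I$ and $f(qn+r)=A_rf(n)$ for $n\ge 0$, $0\le r<q$, $qn+r\ne 0$. Let $\|\cdot\|$ be a norm on $\mathbb{C}^d$ together with its induced matrix norm, and let $$\rho=\inf_{\ell\ge 1}\ \max_{0\le r_1,\dots,r_\ell<q}\|A_{r_1}\cdots A_{r_\ell}\|^{1/\ell}$$ be the joint spectral radius of $A_0,\dots,A_{q-1}$ (with $\log_q 0=-\infty$). Let $\sigma(C)$ be the set of eigenvalues of $C$, let $m(\lambda)$ be the size of the largest Jordan block of $C$ associated with $\lambda$, and put $\chi_\ell=2\pi i\ell/\log q$ for $\ell\in\mathbb{Z}$. For a positive integer $n_0$, let $\mathcal{F}_{n_0}(s)=\sum_{n\ge n_0}n^{-s}f(n)$. Then the following hold for every positive integer $n_0$. (1) The series $\mathcal{F}_{n_0}(s)$ converges absolutely and uniformly on compact subsets of the half plane $\operatorname{Re}s>\log_q\rho+1$;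 in particular, $\mathcal{F}_{n_0}$ is analytic there. (2) For $\operatorname{Re}s>\log_q\rho+1$, we have $(I-q^{-s}C)\mathcal{F}_{n_0}(s)=\mathcal{G}_{n_0}(s)$ with $$\mathcal{G}_{n_0}(s)=\sum_{n_0\le n<qn_0}n^{-s}f(n)+q^{-s}\sum_{0\le r<q}A_r\sum_{k\ge 1}\binom{-s}{k}\Bigl(\frac rq\Bigr)^k\mathcal{F}_{n_0}(s+k).$$ For each $r$, the series over $k$ converges absolutely and uniformly on compact subsets of the half plane $\operatorname{Re}s>\log_q\rho$. (3) $\mathcal{F}_{n_0}$ has a meromorphic continuation (also denoted by $\mathcal{F}_{n_0}$) to the half plane $\operatorname{Re}s>\log_q\rho$. Its only possible poles there are the points $\log_q\lambda+\chi_\ell$ with $\lambda\in\sigma(C)$, $|\lambda|>\rho$ and $\ell\in\mathbb{Z}$, and the order of the pole at $\log_q\lambda+\chi_\ell$ is at most $m(\lambda)$. Outside these points, the continuation satisfies $(I-q^{-s}C)\mathcal{F}_{n_0}(s)=\mathcal{G}_{n_0}(s)$. (4) Let $\delta>0$ and $\mu_\delta(z)=\max\{1-(z-\log_q\rho-\delta),0\}$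 for real $z$ (so $\mu_\delta=0$ if $\rho=0$). There is a constant $K$, independent of $s$, such that $$\|\mathcal{F}_{n_0}(s)\|\le K\max\{1,|\operatorname{Im}s|\}^{\mu_\delta(\operatorname{Re}s)}$$ for all $s$ with $\operatorname{Re}s\ge\log_q\rho+\delta$ and $|q^s-\lambda|\ge\delta$ for all $\lambda\in\sigma(C)$. In particular, $\mathcal{F}_{n_0}(s)=O(|\operatorname{Im}s|^{\mu_\delta(\operatorname{Re}s)})$ as $|\operatorname{Im}s|\to\infty$, uniformly in this region. -/

import Mathlib

noncomputable section

namespace RegDirichlet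

open Matrix

/-- The square complex matrices of size `d`. -/
abbrev Mat (d : ℕ) : Type := Matrix (Fin d) (Fin d) ℂ

/-- The matrix norm induced by a norm `N` on `ℂ^d`: the least `c ≥ 0` with
`N (M x) ≤ c * N x` for all vectors `x`. -/
def opNorm {d : ℕ} (N : Seminorm ℂ (Fin d → ℂ)) (M : Mat d) : ℝ :=
  sInf {c : ℝ | 0 ≤ c ∧ ∀ x : Fin d → ℂ, N (M *ᵥ x) ≤ c * N x}

/-- The joint spectral radius: the infimum over all lengths `ℓ ≥ 1` of the maximum of
`‖A_{r_1} ⋯ A_{r_ℓ}‖^{1/ℓ}` over all words `r_1 … r_ℓ`. -/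
def jointSpectralRadius {q d : ℕ} (N : Seminorm ℂ (Fin d → ℂ)) (A : Fin q → Mat d) : ℝ :=
  ⨅ ℓ : ℕ+, ⨆ w : Fin (ℓ : ℕ) → Fin q,
    opNorm N (List.ofFn fun i => A (w i)).prod ^ (1 / ((ℓ : ℕ) : ℝ))

/-- The sequence of matrices with `f 0 = I` and `f (q n + r) = A_r f n` whenever
`0 ≤ r < q` and `q n + r ≠ 0`. -/
def matSeq {q d : ℕ} (hq : 2 ≤ q) (A : Fin q → Mat d) (n : ℕ) : Mat d :=
  if h : n = 0 then 1
  else A ⟨n % q, Nat.mod_lt n (by omega)⟩ * matSeq hq A (n / q)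
termination_by n
decreasing_by exact Nat.div_lt_self (Nat.pos_of_ne_zero h) (by omega)

theorem matSeq_zero {q d : ℕ} (hq : 2 ≤ q) (A : Fin q → Mat d) : matSeq hq A 0 = 1 := by
  rw [matSeq]; simp

theorem matSeq_rec {q d : ℕ} (hq : 2 ≤ q) (A : Fin q → Mat d) (n : ℕ) (r : Fin q)
    (h : q * n + r ≠ 0) : matSeq hq A (q * n + r) = A r * matSeq hq A n := by
  have h1 : (q * n + r) % q = r := by
    rw [Nat.mul_add_mod, Nat.mod_eq_of_lt r.isLt]
  have h2 : (q * n + r) / q = n := by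
    rw [Nat.mul_add_div (by omega), Nat.div_eq_of_lt r.isLt, Nat.add_zero]
  rw [matSeq, dif_neg h]
  congr 1
  · congr 1
    exact Fin.ext h1
  · rw [h2]

/-- `C = ∑_{0 ≤ r < q} A_r`. -/
def sumMat {q d : ℕ} (A : Fin q → Mat d) : Mat d := ∑ r : Fin q, A r

/-- `log_q x` for `x ≥ 0` as an extended real number, with `log_q 0 = -∞`. -/
def logq (q : ℕ) (x : ℝ) : EReal := if x = 0 then ⊥ else ((Real.logb q x : ℝ) : EReal)

/-- The open half plane `Re s > a`. -/
def halfPlane (a : EReal) : Set ℂ := {s : ℂ | a < ((s.re : ℝ) : EReal)}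

/-- The `n`th term `n^{-s} f(n)` of the Dirichlet series. -/
def dirichletTerm {q d : ℕ} (hq : 2 ≤ q) (A : Fin q → Mat d) (n : ℕ) (s : ℂ) : Mat d :=
  (n : ℂ) ^ (-s) • matSeq hq A n

/-- The matrix-valued Dirichlet series `∑_{n ≥ n₀} n^{-s} f(n)`. -/
def dirichletSeries {q d : ℕ} (hq : 2 ≤ q) (A : Fin q → Mat d) (n₀ : ℕ) (s : ℂ) : Mat d :=
  ∑' n : Set.Ici n₀, dirichletTerm hq A n s

/-- The term `binom(-s, k) (r/q)^k F_{n₀}(s + k)`. -/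
def binomTerm {q d : ℕ} (hq : 2 ≤ q) (A : Fin q → Mat d) (n₀ : ℕ) (r : Fin q) (k : ℕ) (s : ℂ) :
    Mat d :=
  (Ring.choose (-s) k * (((r : ℕ) : ℂ) / (q : ℂ)) ^ k) • dirichletSeries hq A n₀ (s + k)

/-- `G_{n₀}(s) = ∑_{n₀ ≤ n < q n₀} n^{-s} f(n)
  + q^{-s} ∑_{0 ≤ r < q} A_r ∑_{k ≥ 1} binom(-s, k) (r/q)^k F_{n₀}(s + k)`. -/
def inhomogeneity {q d : ℕ} (hq : 2 ≤ q) (A : Fin q → Mat d) (n₀ : ℕ) (s : ℂ) : Mat d :=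
  ∑ n ∈ Finset.Ico n₀ (q * n₀), dirichletTerm hq A n s
    + (q : ℂ) ^ (-s) • ∑ r : Fin q, A r * ∑' k : Set.Ici 1, binomTerm hq A n₀ r k s

/-- The series `∑ᵢ aᵢ(s)` of matrix-valued functions converges absolutely at every point of `U`,
and both it and the series of the norms of its terms converge uniformly on the compact
subsets of `U`. -/
def ConvergesAbsUnifOnCompacts {ι : Type} {d : ℕ} (N : Seminorm ℂ (Fin d → ℂ))
    (a : ι → ℂ → Mat d) (U : Set ℂ) : Prop :=
  (∀ s ∈ U, Summable fun i => opNorm N (a i s)) ∧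
  ∀ K : Set ℂ, K ⊆ U → IsCompact K →
    HasSumUniformlyOn (fun i s => opNorm N (a i s)) (fun s => ∑' i, opNorm N (a i s)) K ∧
    HasSumUniformlyOn a (fun s => ∑' i, a i s) K

/-- The Jordan block of size `m` with eigenvalue `lam`. -/
def jordanBlock (m : ℕ) (lam : ℂ) : Matrix (Fin m) (Fin m) ℂ :=
  Matrix.of fun i j => if i = j then lam else if (i : ℕ) + 1 = j then 1 else 0

/-- The Jordan block of size `m` with eigenvalue `lam` occurs in the Jordan form of `C`, that is,
`C` is similar to a block diagonal matrix which has this Jordan block as one of its blocks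
(transforming the remaining part `W` to Jordan form yields the Jordan form of `C`).
For `m = 0`, this holds trivially. -/
def HasJordanBlock {d : ℕ} (C : Mat d) (lam : ℂ) (m : ℕ) : Prop :=
  ∃ (k : ℕ) (e : Fin d ≃ Fin m ⊕ Fin k) (T : Mat d) (W : Matrix (Fin k) (Fin k) ℂ),
    IsUnit T ∧ T * C * T⁻¹ = (Matrix.fromBlocks (jordanBlock m lam) 0 0 W).submatrix e e

/-- `m(lam)`: the size of the largest Jordan block of `C` associated with `lam`;
it is `0` if `lam` is not an eigenvalue. -/
def maxJordanSize {d : ℕ} (C : Mat d) (lam : ℂ) : ℕ := sSup {m : ℕ | HasJordanBlock C lam m}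

/-- The point `log_q lam + χ_ℓ`, where `χ_ℓ = 2πiℓ / log q`. -/
def polePoint (q : ℕ) (lam : ℂ) (l : ℤ) : ℂ :=
  Complex.log lam / (Real.log q : ℂ) + 2 * (Real.pi : ℂ) * Complex.I * (l : ℂ) / (Real.log q : ℂ)

/-- `μ_δ(z) = max {1 - (z - a - δ), 0}`, where `a = log_q ρ` (for `a = -∞`, this is `0`). -/
def muDelta (a : EReal) (δ z : ℝ) : ℝ :=
  (max (1 - ((z : EReal) - a - (δ : EReal))) 0).toReal

end RegDirichlet

end

noncomputable section

namespace RegDirichlet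

open Matrix Filter Topology
open scoped Matrix.Norms.Elementwise

/-! For R > ρ, products of words of length ℓ are O(R^ℓ) (`exists_opNorm_word_bound`). For n ≥ 1,
f(n) is such a product over the base-q digits of n, with q^ℓ comparable to n. So f(n) = O(n^β)
whenever ρ < q^β (`exists_norm_matSeq_le`), and the series converges for Re s > log_q ρ + 1.

Split the terms with n ≥ q n₀ by residue modulo q. Replacing (qn+r)^{-s} by (qn)^{-s} in them would
give exactly q^{-s} C F(s). The error gains a factor of order 1/n, so it already converges for Re s
> log_q ρ; its binomial expansion is the series over k in G (`hasSum_shiftDiff`,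
`functional_equation`).

The continuation is (I - q^{-s} C)⁻¹ G(s). With μ = q^s and p the minimal polynomial of C, this
inverse is μ h(μ, C) / p(μ), where h is polynomial in μ. Poles need p(q^s) = 0, and their order is
at most the multiplicity of that root, because q^s has nonvanishing derivative. The multiplicity is
the size of an actual Jordan block (`hasJordanBlock_rootMultiplicity`). Eigenvalues of C have
modulus at most qρ, so the inverse exists wherever the series is known to converge, and there the
functional equation itself identifies the continuation with F; no identity theorem is needed.

For the growth, |e^w - 1| is bounded by a multiple of |w|^μ, 0 ≤ μ ≤ 1, which trades decay in n
against powers of |Im s| and bounds G on a strip of width one (`exists_norm_inhomogeneity_le`). The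
resolvent is bounded there by compactness, and to the right of the strip the series is bounded. -/

/-! ### Comparison of norms on vectors and matrices. -/

theorem exists_seminorm_equiv {d : ℕ} (N : Seminorm ℂ (Fin d → ℂ))
    (hN : ∀ x : Fin d → ℂ, N x = 0 → x = 0) :
    ∃ c : ℝ, 0 < c ∧ ∀ x, N x ≤ c * ‖x‖ ∧ ‖x‖ ≤ c * N x := by
  have h1 : ∀ x, N x ≤ (∑ i, N (Pi.single i 1)) * ‖x‖ := by
    intro x
    have hx : x = ∑ i, x i • (Pi.single i (1 : ℂ) : Fin d → ℂ) := pi_eq_sum_univ' x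
    calc N x = N (∑ i, x i • (Pi.single i (1 : ℂ) : Fin d → ℂ)) := by rw [← hx]
      _ ≤ ∑ i, N (x i • (Pi.single i (1 : ℂ) : Fin d → ℂ)) :=
        Finset.le_sum_of_subadditive N (map_zero N).le (map_add_le_add N) _ _
      _ = ∑ i, ‖x i‖ * N (Pi.single i 1) := by simp [map_smul_eq_mul]
      _ ≤ ∑ i, N (Pi.single i 1) * ‖x‖ := by
        refine Finset.sum_le_sum fun i _ => ?_
        rw [mul_comm]
        exact mul_le_mul_of_nonneg_left (norm_le_pi_norm x i) (apply_nonneg N _)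
      _ = _ := by rw [Finset.sum_mul]
  set c₁ := ∑ i, N (Pi.single i 1) with hc₁
  have hc₁0 : 0 ≤ c₁ := Finset.sum_nonneg fun i _ => apply_nonneg N _
  have hcont : Continuous N := by
    refine (LipschitzWith.of_dist_le_mul (K := ⟨c₁, hc₁0⟩) fun x y => ?_).continuous
    rw [Real.dist_eq, dist_eq_norm]
    exact (abs_sub_map_le_sub N x y).trans (h1 _)
  obtain ⟨c₂, hc₂, h2⟩ : ∃ c₂ : ℝ, 0 ≤ c₂ ∧ ∀ x, ‖x‖ ≤ c₂ * N x := by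
    -- The reverse bound comes from the minimum of N on the unit sphere, which is empty only for d =
    -- 0.
    rcases (Metric.sphere (0 : Fin d → ℂ) 1).eq_empty_or_nonempty with he | hne
    · refine ⟨0, le_rfl, fun x => ?_⟩
      by_contra hx
      have hx0 : 0 < ‖x‖ := by simpa using hx
      have : ((‖x‖⁻¹ : ℝ) : ℂ) • x ∈ Metric.sphere (0 : Fin d → ℂ) 1 := by
        simp [norm_smul, hx0.ne']
      rw [he] at this
      exact this
    · obtain ⟨y, hy, hmin⟩ :=
        (isCompact_sphere (0 : Fin d → ℂ) 1).exists_isMinOn hne hcont.continuousOn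
      have hy1 : ‖y‖ = 1 := by simpa using hy
      have hNy : 0 < N y := lt_of_le_of_ne (apply_nonneg N y) fun h => by
        have := hN y h.symm
        simp [this] at hy1
      refine ⟨(N y)⁻¹, by positivity, fun x => ?_⟩
      rcases eq_or_ne x 0 with rfl | hx
      · simp
      have hx0 : 0 < ‖x‖ := norm_pos_iff.2 hx
      have hm : ((‖x‖⁻¹ : ℝ) : ℂ) • x ∈ Metric.sphere (0 : Fin d → ℂ) 1 := by
        simp [norm_smul, hx0.ne']
      have h3 : N y ≤ ‖x‖⁻¹ * N x := by
        have := hmin hm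
        simpa [map_smul_eq_mul] using this
      rw [inv_mul_eq_div, le_div_iff₀ hNy]
      rw [inv_mul_eq_div, le_div_iff₀ hx0] at h3
      linarith
  refine ⟨c₁ + c₂ + 1, by positivity, fun x => ⟨(h1 x).trans ?_, (h2 x).trans ?_⟩⟩
  · exact mul_le_mul_of_nonneg_right (by linarith) (norm_nonneg _)
  · exact mul_le_mul_of_nonneg_right (by linarith) (apply_nonneg N _)

theorem norm_mulVec_le {d : ℕ} (M : Mat d) (x : Fin d → ℂ) : ‖M *ᵥ x‖ ≤ d * ‖M‖ * ‖x‖ := by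
  refine (pi_norm_le_iff_of_nonneg (by positivity)).2 fun i => ?_
  calc ‖∑ j, M i j * x j‖ ≤ ∑ j : Fin d, ‖M i j * x j‖ := norm_sum_le _ _
    _ ≤ ∑ j : Fin d, ‖M‖ * ‖x‖ := by
      refine Finset.sum_le_sum fun j _ => ?_
      rw [norm_mul]
      exact mul_le_mul (Matrix.norm_entry_le_entrywise_sup_norm M) (norm_le_pi_norm x j)
        (norm_nonneg _) (norm_nonneg _)
    _ = _ := by simp [mul_assoc]

/-- The elementwise sup norm is not submultiplicative; the factor d is the number of summands in an
entry of the product. -/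
theorem norm_matrix_mul_le {d : ℕ} (M M' : Mat d) : ‖M * M'‖ ≤ d * ‖M‖ * ‖M'‖ := by
  refine (Matrix.norm_le_iff (by positivity)).2 fun i k => ?_
  rw [Matrix.mul_apply]
  calc ‖∑ j, M i j * M' j k‖ ≤ ∑ j : Fin d, ‖M i j * M' j k‖ := norm_sum_le _ _
    _ ≤ ∑ j : Fin d, ‖M‖ * ‖M'‖ := by
      refine Finset.sum_le_sum fun j _ => ?_
      rw [norm_mul]
      exact mul_le_mul (Matrix.norm_entry_le_entrywise_sup_norm M)
        (Matrix.norm_entry_le_entrywise_sup_norm M') (norm_nonneg _) (norm_nonneg _)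
    _ = _ := by simp [mul_assoc]

/-! ### The induced matrix norm. -/

section OpNorm

variable {d : ℕ} {N : Seminorm ℂ (Fin d → ℂ)}

theorem opNorm_nonneg (M : Mat d) : 0 ≤ opNorm N M := Real.sInf_nonneg fun _ hc => hc.1

theorem opNorm_le {M : Mat d} {c : ℝ} (hc : 0 ≤ c) (h : ∀ x, N (M *ᵥ x) ≤ c * N x) :
    opNorm N M ≤ c :=
  csInf_le ⟨0, fun _ hc => hc.1⟩ ⟨hc, h⟩

theorem exists_apply_mulVec_le (hN : ∀ x : Fin d → ℂ, N x = 0 → x = 0) :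
    ∃ c : ℝ, 0 < c ∧ ∀ (M : Mat d) x, N (M *ᵥ x) ≤ c * ‖M‖ * N x := by
  obtain ⟨c, hc, h⟩ := exists_seminorm_equiv N hN
  -- The factor d + 1 instead of d keeps the constant positive when d = 0.
  refine ⟨c * c * (d + 1), by positivity, fun M x => ?_⟩
  calc N (M *ᵥ x) ≤ c * ‖M *ᵥ x‖ := (h _).1
    _ ≤ c * (d * ‖M‖ * ‖x‖) := by gcongr; exact norm_mulVec_le M x
    _ ≤ c * ((d + 1) * ‖M‖ * (c * N x)) := by
      gcongr
      · linarith
      · exact (h x).2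
    _ = _ := by ring

theorem apply_mulVec_le (hN : ∀ x : Fin d → ℂ, N x = 0 → x = 0) (M : Mat d) (x : Fin d → ℂ) :
    N (M *ᵥ x) ≤ opNorm N M * N x := by
  rcases eq_or_ne (N x) 0 with hx | hx
  · simp [hN x hx]
  have hx0 : 0 < N x := lt_of_le_of_ne (apply_nonneg N x) hx.symm
  rw [← div_le_iff₀ hx0]
  obtain ⟨c, hc, h⟩ := exists_apply_mulVec_le hN
  refine le_csInf ⟨c * ‖M‖, by positivity, h M⟩ fun b hb => ?_
  rw [div_le_iff₀ hx0]
  exact hb.2 x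

theorem opNorm_mul_le (hN : ∀ x : Fin d → ℂ, N x = 0 → x = 0) (M M' : Mat d) :
    opNorm N (M * M') ≤ opNorm N M * opNorm N M' := by
  refine opNorm_le (mul_nonneg (opNorm_nonneg _) (opNorm_nonneg _)) fun x => ?_
  rw [← mulVec_mulVec, mul_assoc]
  exact (apply_mulVec_le hN _ _).trans
    (mul_le_mul_of_nonneg_left (apply_mulVec_le hN _ _) (opNorm_nonneg _))

/-- An entry of M is a coordinate of M applied to a unit vector. This equivalence allows the
analysis to run in the elementwise norm. -/
theorem exists_opNorm_equiv (hN : ∀ x : Fin d → ℂ, N x = 0 → x = 0) :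
    ∃ c : ℝ, 0 < c ∧ ∀ M : Mat d, opNorm N M ≤ c * ‖M‖ ∧ ‖M‖ ≤ c * opNorm N M := by
  obtain ⟨c₁, hc₁, h₁⟩ := exists_apply_mulVec_le hN
  obtain ⟨c, hc, h⟩ := exists_seminorm_equiv N hN
  refine ⟨c₁ + c * c, by positivity, fun M => ⟨?_, ?_⟩⟩
  · refine (opNorm_le (by positivity) (h₁ M)).trans ?_
    gcongr
    nlinarith
  · refine (Matrix.norm_le_iff (mul_nonneg (by positivity) (opNorm_nonneg _))).2 fun i j => ?_
    have he : ‖(Pi.single j 1 : Fin d → ℂ)‖ ≤ 1 := by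
      refine (pi_norm_le_iff_of_nonneg zero_le_one).2 fun k => ?_
      by_cases hk : k = j
      · subst hk; simp
      · simp [hk]
    calc ‖M i j‖ = ‖(M *ᵥ Pi.single j 1) i‖ := by simp
      _ ≤ ‖M *ᵥ Pi.single j 1‖ := norm_le_pi_norm _ i
      _ ≤ c * N (M *ᵥ Pi.single j 1) := (h _).2
      _ ≤ c * (opNorm N M * N (Pi.single j 1)) := by gcongr; exact apply_mulVec_le hN _ _
      _ ≤ c * (opNorm N M * (c * 1)) := by
        have := opNorm_nonneg (N := N) M
        gcongr
        exact (h _).1.trans (by gcongr)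
      _ = c * c * opNorm N M := by ring
      _ ≤ _ := mul_le_mul_of_nonneg_right (by linarith) (opNorm_nonneg _)

end OpNorm

/-! ### Growth of f and the eigenvalues of C. -/

section Growth

variable {q d : ℕ} {N : Seminorm ℂ (Fin d → ℂ)} {A : Fin q → Mat d}

theorem jointSpectralRadius_nonneg : 0 ≤ jointSpectralRadius N A :=
  Real.iInf_nonneg fun _ => Real.iSup_nonneg fun _ => Real.rpow_nonneg (opNorm_nonneg _) _

theorem exists_forall_opNorm_word_le {R : ℝ} (hR : jointSpectralRadius N A < R) :
    ∃ ℓ : ℕ, 0 < ℓ ∧ ∀ l : List (Fin q), l.length = ℓ → opNorm N (l.map A).prod ≤ R ^ ℓ := by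
  obtain ⟨ℓ, hℓ⟩ := exists_lt_of_ciInf_lt hR
  refine ⟨ℓ, ℓ.pos, fun l hl => ?_⟩
  have hR0 : 0 ≤ R := jointSpectralRadius_nonneg.trans hR.le
  have h1 := (le_ciSup (f := fun w : Fin (ℓ : ℕ) → Fin q =>
    opNorm N (List.ofFn fun i => A (w i)).prod ^ (1 / ((ℓ : ℕ) : ℝ)))
    (Set.finite_range _).bddAbove (fun i => l.get (i.cast hl.symm))).trans hℓ.le
  have h2 : (List.ofFn fun i : Fin (ℓ : ℕ) => A (l.get (i.cast hl.symm))) = l.map A := by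
    apply List.ext_getElem
    · simp [hl]
    · intro i h1 h2
      simp
  rw [h2] at h1
  have hℓ0 : ((ℓ : ℕ) : ℝ) ≠ 0 := by exact_mod_cast ℓ.pos.ne'
  calc opNorm N (l.map A).prod = (opNorm N (l.map A).prod ^ (1 / ((ℓ : ℕ) : ℝ))) ^ (ℓ : ℕ) := by
        rw [← Real.rpow_natCast, ← Real.rpow_mul (opNorm_nonneg _), one_div_mul_cancel hℓ0,
          Real.rpow_one]
    _ ≤ R ^ (ℓ : ℕ) := pow_le_pow_left₀ (Real.rpow_nonneg (opNorm_nonneg _) _) h1 _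

/-- Cut the word into blocks of a length ℓ for which every block has norm at most R^ℓ; the constant
K absorbs the remainder, one of finitely many words shorter than ℓ. -/
theorem exists_opNorm_word_bound (hN : ∀ x : Fin d → ℂ, N x = 0 → x = 0) {R : ℝ}
    (hR : jointSpectralRadius N A < R) :
    ∃ K : ℝ, 0 ≤ K ∧ ∀ l : List (Fin q), opNorm N (l.map A).prod ≤ K * R ^ l.length := by
  have hR0 : 0 < R := jointSpectralRadius_nonneg.trans_lt hR
  obtain ⟨ℓ, hℓ, h⟩ := exists_forall_opNorm_word_le hR
  have hfin : {l : List (Fin q) | l.length < ℓ}.Finite := List.finite_length_lt _ _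
  obtain ⟨K, hK⟩ := (hfin.image fun l => opNorm N (l.map A).prod / R ^ l.length).bddAbove
  refine ⟨max K 0, le_max_right _ _, fun l => ?_⟩
  induction hn : l.length using Nat.strong_induction_on generalizing l with
  | _ n ih =>
    subst hn
    by_cases hl : l.length < ℓ
    · have := hK ⟨l, hl, rfl⟩
      rw [← div_le_iff₀ (by positivity)]
      exact this.trans (le_max_left _ _)
    · have hl' : (l.drop ℓ).length = l.length - ℓ := by simp
      have h1 := ih (l.length - ℓ) (by omega) (l.drop ℓ) hl'
      have h2 := h (l.take ℓ) (by simp; omega)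
      calc opNorm N (l.map A).prod
          = opNorm N (((l.take ℓ).map A).prod * ((l.drop ℓ).map A).prod) := by
            rw [← List.prod_append, ← List.map_append, List.take_append_drop]
        _ ≤ _ := opNorm_mul_le hN _ _
        _ ≤ R ^ ℓ * (max K 0 * R ^ (l.length - ℓ)) := by
            exact mul_le_mul h2 h1 (opNorm_nonneg _) (by positivity)
        _ = max K 0 * (R ^ ℓ * R ^ (l.length - ℓ)) := by ring
        _ = _ := by rw [← pow_add]; congr 2; omega

/-- The word lists the base-q digits of n, least significant first. -/
theorem exists_matSeq_eq_word (hq : 2 ≤ q) (A : Fin q → Mat d) (n : ℕ) (hn : 1 ≤ n) :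
    ∃ l : List (Fin q), matSeq hq A n = (l.map A).prod ∧ n < q ^ l.length ∧
      q ^ l.length ≤ q * n := by
  induction n using Nat.strong_induction_on with
  | _ n ih =>
    rw [matSeq, dif_neg (by omega)]
    rcases Nat.eq_zero_or_pos (n / q) with h0 | h0
    · refine ⟨[⟨n % q, Nat.mod_lt n (by omega)⟩], ?_, ?_, ?_⟩
      · simp [h0, matSeq_zero]
      · simpa using (Nat.div_eq_zero_iff.1 h0).resolve_left (by omega)
      · simpa using Nat.le_mul_of_pos_right q hn
    · obtain ⟨l, h1, h2, h3⟩ := ih (n / q) (Nat.div_lt_self hn (by omega)) h0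
      refine ⟨⟨n % q, Nat.mod_lt n (by omega)⟩ :: l, ?_, ?_, ?_⟩
      · simp [h1]
      · rw [List.length_cons, pow_succ]
        exact (Nat.div_lt_iff_lt_mul (by omega)).1 h2
      · rw [List.length_cons, pow_succ, mul_comm]
        exact Nat.mul_le_mul_left q (h3.trans (Nat.mul_div_le n q))

theorem exists_norm_matSeq_le (hN : ∀ x : Fin d → ℂ, N x = 0 → x = 0) (hq : 2 ≤ q) {β : ℝ}
    (hβ : jointSpectralRadius N A < (q : ℝ) ^ β) :
    ∃ K : ℝ, 0 ≤ K ∧ ∀ n : ℕ, 1 ≤ n → ‖matSeq hq A n‖ ≤ K * (n : ℝ) ^ β := by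
  obtain ⟨K, hK, h⟩ := exists_opNorm_word_bound hN hβ
  obtain ⟨c, hc, hcM⟩ := exists_opNorm_equiv hN
  have hq0 : (0 : ℝ) < q := by exact_mod_cast (by omega : 0 < q)
  refine ⟨c * K * max 1 ((q : ℝ) ^ β), by positivity, fun n hn => ?_⟩
  have hn0 : (0 : ℝ) < n := by exact_mod_cast hn
  obtain ⟨l, h1, h2, h3⟩ := exists_matSeq_eq_word hq A n hn
  have h2' : (n : ℝ) ≤ (q : ℝ) ^ l.length := by exact_mod_cast h2.le
  have h3' : (q : ℝ) ^ l.length ≤ q * n := by exact_mod_cast h3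
  have key : ((q : ℝ) ^ β) ^ l.length ≤ max 1 ((q : ℝ) ^ β) * (n : ℝ) ^ β := by
    rw [← Real.rpow_natCast, ← Real.rpow_mul hq0.le, mul_comm β, Real.rpow_mul hq0.le,
      Real.rpow_natCast]
    -- The sign of β decides which of n ≤ q^ℓ ≤ qn is used; hence the maximum of 1 and q^β in the
    -- constant.
    rcases le_total 0 β with hβ0 | hβ0
    · calc ((q : ℝ) ^ l.length) ^ β ≤ (q * n : ℝ) ^ β :=
            Real.rpow_le_rpow (by positivity) h3' hβ0
        _ = (q : ℝ) ^ β * (n : ℝ) ^ β := Real.mul_rpow hq0.le hn0.le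
        _ ≤ _ := by gcongr; exact le_max_right _ _
    · calc ((q : ℝ) ^ l.length) ^ β ≤ (n : ℝ) ^ β := Real.rpow_le_rpow_of_nonpos hn0 h2' hβ0
        _ = 1 * (n : ℝ) ^ β := (one_mul _).symm
        _ ≤ _ := by gcongr; exact le_max_left _ _
  calc ‖matSeq hq A n‖ ≤ c * opNorm N (matSeq hq A n) := (hcM _).2
    _ ≤ c * (K * (((q : ℝ) ^ β) ^ l.length)) := by rw [h1]; gcongr; exact h l
    _ ≤ c * (K * (max 1 ((q : ℝ) ^ β) * (n : ℝ) ^ β)) := by gcongr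
    _ = _ := by ring

/-- Expanding one factor C at a time appends a letter to the word, so the prefix `l` is what makes
the induction run. The empty prefix bounds C^m by a multiple of (qR)^m. -/
theorem apply_word_mul_sumMat_pow_le {K R : ℝ} (hN : ∀ x : Fin d → ℂ, N x = 0 → x = 0)
    (h : ∀ l : List (Fin q), opNorm N (l.map A).prod ≤ K * R ^ l.length) (m : ℕ)
    (l : List (Fin q)) (x : Fin d → ℂ) :
    N (((l.map A).prod * sumMat A ^ m) *ᵥ x) ≤ (q : ℝ) ^ m * (K * R ^ (l.length + m)) * N x := by
  induction m generalizing l with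
  | zero =>
    simp only [pow_zero, mul_one, one_mul, add_zero]
    exact (apply_mulVec_le hN _ _).trans
      (mul_le_mul_of_nonneg_right (h l) (apply_nonneg N x))
  | succ m ih =>
    have h1 : ((l.map A).prod * sumMat A ^ (m + 1)) *ᵥ x
        = ∑ r : Fin q, (((l ++ [r]).map A).prod * sumMat A ^ m) *ᵥ x := by
      rw [pow_succ', ← mul_assoc]
      nth_rewrite 1 [sumMat]
      rw [Finset.mul_sum, Finset.sum_mul, Matrix.sum_mulVec]
      simp
    rw [h1]
    calc N (∑ r : Fin q, (((l ++ [r]).map A).prod * sumMat A ^ m) *ᵥ x)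
        ≤ ∑ r : Fin q, N ((((l ++ [r]).map A).prod * sumMat A ^ m) *ᵥ x) :=
          Finset.le_sum_of_subadditive N (map_zero N).le (map_add_le_add N) _ _
      _ ≤ ∑ r : Fin q, (q : ℝ) ^ m * (K * R ^ (l.length + (m + 1))) * N x := by
          refine Finset.sum_le_sum fun r _ => (ih _).trans (le_of_eq ?_)
          simp only [List.length_append, List.length_cons, List.length_nil]
          ring_nf
      _ = _ := by simp; ring

/-- Applying C^m to an eigenvector gives |λ|^m ≤ K (qR)^m for all m, which fails for large m if |λ|
> qR. -/
theorem norm_le_of_mem_spectrum_sumMat (hN : ∀ x : Fin d → ℂ, N x = 0 → x = 0) {R : ℝ}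
    (hR : jointSpectralRadius N A < R) {lam : ℂ} (hlam : lam ∈ spectrum ℂ (sumMat A)) :
    ‖lam‖ ≤ q * R := by
  obtain ⟨K, hK, h⟩ := exists_opNorm_word_bound hN hR
  have hR0 : 0 < R := jointSpectralRadius_nonneg.trans_lt hR
  rw [← Matrix.spectrum_toLin', ← Module.End.hasEigenvalue_iff_mem_spectrum] at hlam
  obtain ⟨v, hv⟩ := hlam.exists_hasEigenvector
  have hv1 : sumMat A *ᵥ v = lam • v := by simpa using hv.apply_eq_smul
  have hpow : ∀ m : ℕ, sumMat A ^ m *ᵥ v = lam ^ m • v := by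
    intro m
    induction m with
    | zero => simp
    | succ m ih => rw [pow_succ, ← mulVec_mulVec, hv1, mulVec_smul, ih, smul_smul, pow_succ']
  have hNv : 0 < N v := lt_of_le_of_ne (apply_nonneg N v) fun h => hv.2 (hN v h.symm)
  have hbd : ∀ m : ℕ, ‖lam‖ ^ m ≤ K * (q * R) ^ m := by
    intro m
    have := apply_word_mul_sumMat_pow_le hN h m [] v
    simp only [List.map_nil, List.prod_nil, one_mul, hpow, map_smul_eq_mul, norm_pow,
      List.length_nil, zero_add] at this
    have := le_of_mul_le_mul_right this hNv
    rw [mul_pow]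
    linarith
  by_contra hlt
  push Not at hlt
  have hlam0 : 0 < ‖lam‖ := lt_of_le_of_lt (by positivity) hlt
  have hx : q * R / ‖lam‖ < 1 := (div_lt_one hlam0).2 hlt
  have hlim := (tendsto_pow_atTop_nhds_zero_of_lt_one (by positivity) hx).const_mul K
  rw [mul_zero] at hlim
  obtain ⟨m, hm⟩ := (hlim.eventually (gt_mem_nhds zero_lt_one)).exists
  have := hbd m
  rw [div_pow, ← mul_div_assoc, div_lt_one (by positivity)] at hm
  linarith

end Growth

/-! ### Locally uniform convergence from summable majorants. -/

section Convergence

variable {d : ℕ} {N : Seminorm ℂ (Fin d → ℂ)}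

theorem isOpen_halfPlane (α : EReal) : IsOpen (halfPlane α) :=
  isOpen_lt continuous_const (continuous_coe_real_ereal.comp Complex.continuous_re)

/-- On every bounded part of every closed half plane inside `Re s > α`, the series `∑ᵢ aᵢ` has a
summable majorant. -/
def LocallyDominated {ι : Type} (a : ι → ℂ → Mat d) (α : EReal) : Prop :=
  ∀ b S : ℝ, α < b → ∃ u : ι → ℝ, Summable u ∧
    ∀ i s, b ≤ s.re → ‖s‖ ≤ S → ‖a i s‖ ≤ u i

theorem LocallyDominated.summable_norm {ι : Type} {a : ι → ℂ → Mat d} {α : EReal}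
    (h : LocallyDominated a α) {s : ℂ} (hs : s ∈ halfPlane α) : Summable fun i => ‖a i s‖ := by
  obtain ⟨u, hu, hau⟩ := h s.re ‖s‖ hs
  exact hu.of_nonneg_of_le (fun _ => norm_nonneg _) fun i => hau i s le_rfl le_rfl

theorem LocallyDominated.summable {ι : Type} {a : ι → ℂ → Mat d} {α : EReal}
    (h : LocallyDominated a α) {s : ℂ} (hs : s ∈ halfPlane α) : Summable fun i => a i s :=
  (h.summable_norm hs).of_norm

/-- Weierstrass M-test: on a nonempty compact set Re s attains a minimum, still above α, and |s| is
bounded. -/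
theorem LocallyDominated.convergesAbsUnifOnCompacts {ι : Type} {a : ι → ℂ → Mat d} {α : EReal}
    (h : LocallyDominated a α) (hN : ∀ x : Fin d → ℂ, N x = 0 → x = 0) :
    ConvergesAbsUnifOnCompacts N a (halfPlane α) := by
  obtain ⟨c, hc, hcM⟩ := exists_opNorm_equiv hN
  refine ⟨fun s hs => ((h.summable_norm hs).mul_left c).of_nonneg_of_le
    (fun _ => opNorm_nonneg _) fun i => (hcM _).1, fun K hKU hK => ?_⟩
  obtain ⟨u, hu, hau⟩ : ∃ u : ι → ℝ, Summable u ∧ ∀ i, ∀ s ∈ K, ‖a i s‖ ≤ u i := by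
    rcases K.eq_empty_or_nonempty with rfl | hne
    · exact ⟨0, summable_zero, by simp⟩
    · obtain ⟨s₀, hs₀, hmin⟩ := hK.exists_isMinOn hne Complex.continuous_re.continuousOn
      obtain ⟨S, hS⟩ := hK.isBounded.exists_norm_le
      obtain ⟨u, hu, hau⟩ := h s₀.re S (hKU hs₀)
      exact ⟨u, hu, fun i s hs => hau i s (hmin hs) (hS s hs)⟩
  refine ⟨.of_norm_le_summable (hu.mul_left c) fun i s hs => ?_,
    .of_norm_le_summable hu fun i s hs => hau i s hs⟩
  rw [Real.norm_of_nonneg (opNorm_nonneg _)]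
  exact (hcM _).1.trans (by gcongr; exact hau i s hs)

theorem LocallyDominated.differentiableOn {ι : Type} {a : ι → ℂ → Mat d} {α : EReal}
    (h : LocallyDominated a α) (ha : ∀ i, DifferentiableOn ℂ (a i) (halfPlane α)) :
    DifferentiableOn ℂ (fun s => ∑' i, a i s) (halfPlane α) := by
  intro s hs
  obtain ⟨b, hb₁, hb₂⟩ := EReal.lt_iff_exists_real_btwn.1 hs
  obtain ⟨u, hu, hau⟩ := h b (‖s‖ + 1) hb₁
  have hU : IsOpen ({z : ℂ | b < z.re} ∩ {z | ‖z‖ < ‖s‖ + 1}) :=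
    (isOpen_lt continuous_const Complex.continuous_re).inter
      (isOpen_lt continuous_norm continuous_const)
  have hsU : s ∈ {z : ℂ | b < z.re} ∩ {z | ‖z‖ < ‖s‖ + 1} :=
    ⟨by exact_mod_cast hb₂, by simp⟩
  have hsub : {z : ℂ | b < z.re} ∩ {z | ‖z‖ < ‖s‖ + 1} ⊆ halfPlane α := fun z hz =>
    hb₁.trans (by exact_mod_cast hz.1)
  have := Complex.differentiableOn_tsum_of_summable_norm hu (fun i => (ha i).mono hsub) hU
    fun i z hz => hau i z (le_of_lt hz.1) (le_of_lt hz.2)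
  exact (this.differentiableAt (hU.mem_nhds hsU)).differentiableWithinAt

theorem analyticOnNhd_entry {F : ℂ → Mat d} {α : EReal}
    (h : DifferentiableOn ℂ F (halfPlane α)) (i j : Fin d) :
    AnalyticOnNhd ℂ (fun s => F s i j) (halfPlane α) :=
  DifferentiableOn.analyticOnNhd
    (differentiableOn_pi.1 (differentiableOn_pi.1 h i) j) (isOpen_halfPlane α)

end Convergence

/-! ### Binomial coefficients and the binomial series. -/

section Binomial

theorem choose_succ_eq (a : ℂ) (k : ℕ) :
    Ring.choose a (k + 1) = Ring.choose a k * (a - k) / (k + 1) := by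
  have hk : (k.factorial : ℂ) ≠ 0 := by exact_mod_cast k.factorial_ne_zero
  have hk1 : (k : ℂ) + 1 ≠ 0 := by exact_mod_cast k.succ_ne_zero
  rw [Ring.choose_eq_smul, Ring.choose_eq_smul, descPochhammer_succ_right, Polynomial.smeval_mul,
    Nat.factorial_succ]
  simp [Polynomial.smeval_natCast]
  field_simp

/-- Consecutive coefficients have ratio at most (k+1+S)/(k+1), which is exactly the ratio for
binom(k+S, S). The growth in k is thus polynomial, uniformly for bounded s. -/
theorem norm_choose_neg_le {s : ℂ} {S : ℕ} (hs : ‖s‖ ≤ S) (k : ℕ) :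
    ‖Ring.choose (-s) k‖ ≤ (k + S).choose S := by
  induction k with
  | zero => simp
  | succ k ih =>
    have hk1 : (0 : ℝ) < k + 1 := by positivity
    have h1 : ‖-s - (k : ℂ)‖ ≤ k + 1 + S := by
      calc ‖-s - (k : ℂ)‖ ≤ ‖-s‖ + ‖(k : ℂ)‖ := norm_sub_le _ _
        _ ≤ S + k := by simpa using hs
        _ ≤ _ := by linarith
    have h2 : ((k + 1 + S).choose S : ℝ) * (k + 1) = (k + S).choose S * (k + 1 + S) := by
      have := Nat.add_one_mul_choose_eq (k + S) k
      rw [Nat.choose_symm_add, show k + S + 1 = (k + 1) + S by ring, Nat.choose_symm_add] at this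
      have h : ((k + 1 + S : ℕ) : ℝ) * ((k + S).choose S : ℝ)
        = ((k + 1 + S).choose S : ℝ) * ((k + 1 : ℕ) : ℝ) := by exact_mod_cast this
      push_cast at h
      linarith
    rw [choose_succ_eq, norm_div, norm_mul]
    have h3 : ‖(k : ℂ) + 1‖ = k + 1 := by
      rw [← Nat.cast_succ, Complex.norm_natCast]; simp
    rw [h3, div_le_iff₀ hk1, h2]
    exact mul_le_mul ih h1 (norm_nonneg _) (by positivity)

theorem hasSum_choose_mul_pow (a : ℂ) {x : ℂ} (hx : ‖x‖ < 1) :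
    HasSum (fun k => Ring.choose a k * x ^ k) ((1 + x) ^ a) := by
  have := (Complex.one_add_cpow_hasFPowerSeriesOnBall_zero (a := a)).hasSum (y := x)
    (by simpa [enorm_eq_nnnorm, ← NNReal.coe_lt_coe] using hx)
  simpa [binomialSeries, mul_comm] using this

end Binomial

/-! ### Majorants for the two series. -/

section Terms

variable {q d : ℕ} {A : Fin q → Mat d} {β K : ℝ} {n₀ : ℕ}

theorem norm_natCast_cpow_neg {n : ℕ} (hn : 1 ≤ n) (s : ℂ) :
    ‖(n : ℂ) ^ (-s)‖ = (n : ℝ) ^ (-s.re) := by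
  rw [Complex.norm_natCast_cpow_of_pos hn, Complex.neg_re]

theorem norm_dirichletTerm_le (hq : 2 ≤ q)
    (hf : ∀ n : ℕ, 1 ≤ n → ‖matSeq hq A n‖ ≤ K * (n : ℝ) ^ β)
    {n : ℕ} (hn : 1 ≤ n) {s : ℂ} {b : ℝ} (hb : b ≤ s.re) :
    ‖dirichletTerm hq A n s‖ ≤ K * (n : ℝ) ^ (β - b) := by
  have hn0 : (0 : ℝ) < n := by exact_mod_cast hn
  rw [dirichletTerm, norm_smul, norm_natCast_cpow_neg hn]
  calc (n : ℝ) ^ (-s.re) * ‖matSeq hq A n‖ ≤ (n : ℝ) ^ (-b) * (K * (n : ℝ) ^ β) := by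
        gcongr
        · exact_mod_cast hn
        · exact hf n hn
    _ = _ := by rw [sub_eq_neg_add, Real.rpow_add hn0]; ring

theorem summable_natCast_rpow_Ici {c : ℝ} (hc : c < -1) (n₀ : ℕ) :
    Summable fun n : Set.Ici n₀ => ((n : ℕ) : ℝ) ^ c :=
  (Real.summable_nat_rpow.2 hc).subtype _

theorem exists_dirichletTerm_majorant (hq : 2 ≤ q)
    (hf : ∀ n : ℕ, 1 ≤ n → ‖matSeq hq A n‖ ≤ K * (n : ℝ) ^ β) (hn₀ : 1 ≤ n₀) {b : ℝ}
    (hb : β + 1 < b) :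
    ∃ u : Set.Ici n₀ → ℝ, Summable u ∧
      ∀ (n : Set.Ici n₀) s, b ≤ s.re → ‖dirichletTerm hq A n s‖ ≤ u n :=
  ⟨fun n => K * ((n : ℕ) : ℝ) ^ (β - b),
    (summable_natCast_rpow_Ici (by linarith) n₀).mul_left K,
    fun n _ hs => norm_dirichletTerm_le hq hf (hn₀.trans n.2) hs⟩

theorem exists_norm_dirichletSeries_le (hq : 2 ≤ q)
    (hf : ∀ n : ℕ, 1 ≤ n → ‖matSeq hq A n‖ ≤ K * (n : ℝ) ^ β) (hn₀ : 1 ≤ n₀) {b : ℝ}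
    (hb : β + 1 < b) :
    ∃ B : ℝ, 0 ≤ B ∧ ∀ s : ℂ, b ≤ s.re → ‖dirichletSeries hq A n₀ s‖ ≤ B := by
  obtain ⟨u, hu, h⟩ := exists_dirichletTerm_majorant hq hf hn₀ hb
  refine ⟨max (∑' n, u n) 0, le_max_right _ _, fun s hs => ?_⟩
  exact (tsum_of_norm_bounded hu.hasSum fun n => h n s hs).trans (le_max_left _ _)

theorem differentiable_natCast_cpow_neg {n : ℕ} (hn : n ≠ 0) :
    Differentiable ℂ fun s : ℂ => (n : ℂ) ^ (-s) := fun s =>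
  (differentiableAt_id.neg).const_cpow (Or.inl (by exact_mod_cast hn))

theorem differentiable_dirichletTerm (hq : 2 ≤ q) (A : Fin q → Mat d) {n : ℕ} (hn : 1 ≤ n) :
    Differentiable ℂ (dirichletTerm hq A n) :=
  (differentiable_natCast_cpow_neg (by omega)).smul_const _

/-- Since k ≥ 1, the point s + k has real part at least b + 1 > β + 1, where F is bounded; since r <
q, the factor (r/q)^k beats the polynomial growth of the coefficients. -/
theorem exists_binomTerm_majorant (hq : 2 ≤ q)
    (hf : ∀ n : ℕ, 1 ≤ n → ‖matSeq hq A n‖ ≤ K * (n : ℝ) ^ β) (hn₀ : 1 ≤ n₀) {b : ℝ}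
    (hb : β < b) (S : ℝ) (r : Fin q) :
    ∃ u : Set.Ici 1 → ℝ, Summable u ∧
      ∀ (k : Set.Ici 1) s, b ≤ s.re → ‖s‖ ≤ S → ‖binomTerm hq A n₀ r k s‖ ≤ u k := by
  obtain ⟨B, hB, h⟩ := exists_norm_dirichletSeries_le hq hf hn₀ (b := b + 1) (by linarith)
  obtain ⟨m, hm⟩ := exists_nat_ge S
  have hq0 : (0 : ℝ) < q := by exact_mod_cast (by omega : 0 < q)
  have hr : ‖((r : ℕ) : ℝ) / q‖ < 1 := by
    rw [Real.norm_of_nonneg (by positivity), div_lt_one hq0]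
    exact_mod_cast r.2
  refine ⟨fun k => ((k : ℕ) + m).choose m * (((r : ℕ) : ℝ) / q) ^ (k : ℕ) * B,
    ((summable_choose_mul_geometric_of_norm_lt_one m hr).mul_right B).subtype _,
    fun k s hs hS => ?_⟩
  rw [binomTerm, norm_smul, norm_mul, norm_pow, norm_div, Complex.norm_natCast,
    Complex.norm_natCast]
  have hk : (1 : ℝ) ≤ (k : ℕ) := by exact_mod_cast k.2
  beta_reduce
  gcongr
  · exact norm_choose_neg_le (hS.trans hm) k
  · exact h _ (by simpa using add_le_add hs hk)

end Terms

/-! ### Convergence and analyticity on half planes bounded in terms of log_q ρ. -/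

section JointSpectralRadius

variable {q d : ℕ} {N : Seminorm ℂ (Fin d → ℂ)} {A : Fin q → Mat d}

theorem lt_rpow_of_logq_lt (hq : 2 ≤ q) {ρ β : ℝ} (hρ : 0 ≤ ρ) (h : logq q ρ < (β : EReal)) :
    ρ < (q : ℝ) ^ β := by
  have hq1 : (1 : ℝ) < q := by exact_mod_cast (by omega : 1 < q)
  rcases hρ.eq_or_lt with rfl | h0
  · positivity
  · rw [logq, if_neg h0.ne', EReal.coe_lt_coe_iff] at h
    exact (Real.logb_lt_iff_lt_rpow hq1 h0).1 h

theorem logq_lt_of_lt_rpow (hq : 2 ≤ q) {ρ β : ℝ} (hρ : 0 ≤ ρ) (h : ρ < (q : ℝ) ^ β) :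
    logq q ρ < (β : EReal) := by
  have hq1 : (1 : ℝ) < q := by exact_mod_cast (by omega : 1 < q)
  rcases hρ.eq_or_lt with rfl | h0
  · rw [logq, if_pos rfl]; exact EReal.bot_lt_coe β
  · rw [logq, if_neg h0.ne', EReal.coe_lt_coe_iff]
    exact (Real.logb_lt_iff_lt_rpow hq1 h0).2 h

theorem exists_norm_matSeq_le_of_logq_lt (hN : ∀ x : Fin d → ℂ, N x = 0 → x = 0) (hq : 2 ≤ q)
    {b : ℝ} (hb : logq q (jointSpectralRadius N A) < b) :
    ∃ β K : ℝ, logq q (jointSpectralRadius N A) < β ∧ β < b ∧ 0 ≤ K ∧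
      ∀ n : ℕ, 1 ≤ n → ‖matSeq hq A n‖ ≤ K * (n : ℝ) ^ β := by
  obtain ⟨β, hβ₁, hβ₂⟩ := EReal.lt_iff_exists_real_btwn.1 hb
  obtain ⟨K, hK, h⟩ := exists_norm_matSeq_le (A := A) hN hq
    (lt_rpow_of_logq_lt hq jointSpectralRadius_nonneg hβ₁)
  exact ⟨β, K, hβ₁, by exact_mod_cast hβ₂, hK, h⟩

theorem lt_sub_one_of_add_one_lt {α : EReal} {b : ℝ} (h : α + 1 < (b : EReal)) :
    α < ((b - 1 : ℝ) : EReal) := by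
  induction α with
  | bot => exact EReal.bot_lt_coe _
  | top => exact absurd h (by
    rw [show (⊤ : EReal) + 1 = ⊤ from EReal.top_add_of_ne_bot (EReal.coe_ne_bot 1)]
    exact not_top_lt)
  | coe x =>
    have : x + 1 < b := by exact_mod_cast h
    exact_mod_cast (by linarith : x < b - 1)

theorem dirichletTerm_locallyDominated (hN : ∀ x : Fin d → ℂ, N x = 0 → x = 0) (hq : 2 ≤ q)
    {n₀ : ℕ} (hn₀ : 1 ≤ n₀) :
    LocallyDominated (fun (n : Set.Ici n₀) s => dirichletTerm hq A n s)
      (logq q (jointSpectralRadius N A) + 1) := by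
  intro b S hb
  obtain ⟨β, K, -, hβ, -, hf⟩ :=
    exists_norm_matSeq_le_of_logq_lt (A := A) hN hq (lt_sub_one_of_add_one_lt hb)
  obtain ⟨u, hu, h⟩ := exists_dirichletTerm_majorant hq hf hn₀ (b := b) (by linarith)
  exact ⟨u, hu, fun n s hs _ => h n s hs⟩

theorem binomTerm_locallyDominated (hN : ∀ x : Fin d → ℂ, N x = 0 → x = 0) (hq : 2 ≤ q)
    {n₀ : ℕ} (hn₀ : 1 ≤ n₀) (r : Fin q) :
    LocallyDominated (fun (k : Set.Ici 1) s => binomTerm hq A n₀ r k s)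
      (logq q (jointSpectralRadius N A)) := by
  intro b S hb
  obtain ⟨β, K, -, hβ, -, hf⟩ := exists_norm_matSeq_le_of_logq_lt (A := A) hN hq hb
  exact exists_binomTerm_majorant hq hf hn₀ hβ S r

theorem differentiableOn_dirichletSeries (hN : ∀ x : Fin d → ℂ, N x = 0 → x = 0) (hq : 2 ≤ q)
    {n₀ : ℕ} (hn₀ : 1 ≤ n₀) :
    DifferentiableOn ℂ (dirichletSeries hq A n₀)
      (halfPlane (logq q (jointSpectralRadius N A) + 1)) :=
  (dirichletTerm_locallyDominated hN hq hn₀).differentiableOn fun n =>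
    (differentiable_dirichletTerm hq A (hn₀.trans n.2)).differentiableOn

theorem add_natCast_mem_halfPlane {α : EReal} {s : ℂ} (hs : s ∈ halfPlane α) {k : ℕ}
    (hk : 1 ≤ k) : s + k ∈ halfPlane (α + 1) := by
  change α < ((s.re : ℝ) : EReal) at hs
  change α + 1 < (((s + k).re : ℝ) : EReal)
  have hk' : (1 : ℝ) ≤ k := by exact_mod_cast hk
  induction α with
  | bot => exact EReal.bot_lt_coe _
  | top => simp at hs
  | coe x =>
    have : x < s.re := by exact_mod_cast hs
    have h : x + 1 < (s + k).re := by simp; linarith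
    exact_mod_cast h

theorem differentiable_choose_neg (k : ℕ) : Differentiable ℂ fun s : ℂ => Ring.choose (-s) k := by
  induction k with
  | zero => simp
  | succ k ih =>
    simp only [choose_succ_eq]
    fun_prop

theorem differentiableOn_inhomogeneity (hN : ∀ x : Fin d → ℂ, N x = 0 → x = 0) (hq : 2 ≤ q)
    {n₀ : ℕ} (hn₀ : 1 ≤ n₀) :
    DifferentiableOn ℂ (inhomogeneity hq A n₀) (halfPlane (logq q (jointSpectralRadius N A))) := by
  refine .fun_add (.fun_sum fun n hn => ?_) (.fun_smul ?_ (.fun_sum fun r _ => ?_))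
  · exact (differentiable_dirichletTerm hq A
      (hn₀.trans (Finset.mem_Ico.1 hn).1)).differentiableOn
  · exact (differentiable_natCast_cpow_neg (by omega)).differentiableOn
  · have h := (binomTerm_locallyDominated (A := A) hN hq hn₀ r).differentiableOn fun k => by
      refine DifferentiableOn.fun_smul ?_ ?_
      · exact ((differentiable_choose_neg k).mul_const _).differentiableOn
      · exact (differentiableOn_dirichletSeries (A := A) hN hq hn₀).comp
          (differentiable_id.add_const _).differentiableOn
          fun s hs => add_natCast_mem_halfPlane hs k.2
    exact ((LinearMap.mulLeft ℂ (A r)).toContinuousLinearMap.differentiable.comp_differentiableOn h)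

end JointSpectralRadius

/-! ### The functional equation. -/

section FunctionalEquation

variable {q d : ℕ} {N : Seminorm ℂ (Fin d → ℂ)} {A : Fin q → Mat d} {n₀ : ℕ}

/-- The difference `(qn + r)^{-s} - (qn)^{-s}`. -/
def shiftDiff (q r n : ℕ) (s : ℂ) : ℂ :=
  ((q * n + r : ℕ) : ℂ) ^ (-s) - ((q * n : ℕ) : ℂ) ^ (-s)

theorem shiftDiff_eq {q r n : ℕ} (hq : 1 ≤ q) (hn : 1 ≤ n) (s : ℂ) :
    shiftDiff q r n s
      = (q : ℂ) ^ (-s) * ((n : ℂ) ^ (-s) * ((1 + (r : ℂ) / q / n) ^ (-s) - 1)) := by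
  have hq0 : (q : ℝ) ≠ 0 := by exact_mod_cast (by omega : q ≠ 0)
  have hn0 : (n : ℝ) ≠ 0 := by exact_mod_cast (by omega : n ≠ 0)
  have h1 : ((q * n + r : ℕ) : ℂ)
      = ((q * n : ℕ) : ℝ) * ((1 + (r : ℝ) / q / n : ℝ) : ℂ) := by
    rw [← Complex.ofReal_mul, ← Complex.ofReal_natCast]
    congr 1
    push_cast
    field_simp
  have h2 : ((1 + (r : ℝ) / q / n : ℝ) : ℂ) = 1 + (r : ℂ) / q / n := by push_cast; ring
  rw [shiftDiff, h1, Complex.mul_cpow_ofReal_nonneg (by positivity) (by positivity), h2,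
    Complex.ofReal_natCast, Nat.cast_mul, Complex.natCast_mul_natCast_cpow]
  ring

theorem norm_div_div_lt_one {q r n : ℕ} (hr : r < q) (hn : 1 ≤ n) :
    ‖(r : ℂ) / q / n‖ < 1 := by
  have hq0 : (0 : ℝ) < q := by exact_mod_cast (by omega : 0 < q)
  have hn1 : (1 : ℝ) ≤ n := by exact_mod_cast hn
  have hr' : (r : ℝ) < q := by exact_mod_cast hr
  rw [norm_div, norm_div, Complex.norm_natCast, Complex.norm_natCast, Complex.norm_natCast,
    div_div, div_lt_one (by positivity)]
  nlinarith

theorem hasSum_binom_sub_one {q r n : ℕ} (hr : r < q) (hn : 1 ≤ n) (s : ℂ) :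
    HasSum (fun k : Set.Ici 1 =>
      Ring.choose (-s) (k : ℕ) * ((r : ℂ) / q) ^ (k : ℕ) * (n : ℂ) ^ (-(s + (k : ℕ))))
      ((n : ℂ) ^ (-s) * ((1 + (r : ℂ) / q / n) ^ (-s) - 1)) := by
  have hn0 : (n : ℂ) ≠ 0 := by exact_mod_cast (by omega : n ≠ 0)
  -- Updating the value at 0 to 0 deletes the term k = 0 of the binomial series, which accounts for
  -- the -1 in the sum.
  have h := ((hasSum_choose_mul_pow (-s) (norm_div_div_lt_one hr hn)).update 0 0).mul_left
    ((n : ℂ) ^ (-s))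
  have e1 : ((Set.Ici 1).indicator fun k : ℕ =>
      Ring.choose (-s) k * ((r : ℂ) / q) ^ k * (n : ℂ) ^ (-(s + k))) = fun k => (n : ℂ) ^ (-s) *
        Function.update (fun k => Ring.choose (-s) k * ((r : ℂ) / q / n) ^ k) 0 0 k := by
    funext k
    rcases Nat.eq_zero_or_pos k with rfl | hk
    · simp
    · rw [Set.indicator_of_mem (by exact hk), Function.update_of_ne (by omega), neg_add,
        Complex.cpow_add _ _ hn0, Complex.cpow_neg _ (k : ℂ), Complex.cpow_natCast,
        div_pow _ (n : ℂ)]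
      field_simp
  have e2 : (n : ℂ) ^ (-s) * ((1 + (r : ℂ) / q / n) ^ (-s) - 1) = (n : ℂ) ^ (-s) *
      (0 - Ring.choose (-s) 0 * ((r : ℂ) / q / n) ^ 0 + (1 + (r : ℂ) / q / n) ^ (-s)) := by
    rw [Ring.choose_zero_right, pow_zero]
    ring
  rw [← e1, ← e2] at h
  exact hasSum_subtype_iff_indicator.2 h

theorem hasSum_smul_of_summable_prod {ι κ E : Type*} [NormedAddCommGroup E] [NormedSpace ℂ E]
    [CompleteSpace E] {c : ι → κ → ℂ} {v : κ → E} {g : κ → ℂ}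
    (h : Summable fun p : ι × κ => c p.1 p.2 • v p.2) (hg : ∀ n, HasSum (fun k => c k n) (g n)) :
    HasSum (fun n => g n • v n) (∑' k, ∑' n, c k n • v n) := by
  have h1 : ∀ n, g n • v n = ∑' k, c k n • v n := fun n =>
    ((hg n).smul_const (v n)).tsum_eq.symm
  have h2 : Summable fun n => g n • v n := h.prod_symm.prod.congr fun n => (h1 n).symm
  rw [Summable.tsum_comm (f := fun n k => c k n • v n) h.prod_symm, ← tsum_congr h1]
  exact h2.hasSum

/-- Justifies exchanging the sums over k and n. As k ≥ 1, n^{-(s+k)} f(n) is at most K n^{β - Re s -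
1}, so a product of a series in k and one in n dominates. -/
theorem summable_binom_dirichletTerm (hN : ∀ x : Fin d → ℂ, N x = 0 → x = 0) (hq : 2 ≤ q)
    (hn₀ : 1 ≤ n₀) (r : Fin q) {s : ℂ}
    (hs : s ∈ halfPlane (logq q (jointSpectralRadius N A))) :
    Summable fun p : Set.Ici 1 × Set.Ici n₀ =>
      (Ring.choose (-s) (p.1 : ℕ) * (((r : ℕ) : ℂ) / (q : ℂ)) ^ (p.1 : ℕ)) •
        dirichletTerm hq A p.2 (s + (p.1 : ℕ)) := by
  obtain ⟨β, K, -, hβ, hK, hf⟩ := exists_norm_matSeq_le_of_logq_lt (A := A) hN hq hs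
  obtain ⟨m, hm⟩ := exists_nat_ge ‖s‖
  have hq0 : (0 : ℝ) < q := by exact_mod_cast (by omega : 0 < q)
  have hr : ‖((r : ℕ) : ℝ) / q‖ < 1 := by
    rw [Real.norm_of_nonneg (by positivity), div_lt_one hq0]
    exact_mod_cast r.2
  have h1 : Summable fun k : Set.Ici 1 =>
      (((k : ℕ) + m).choose m * (((r : ℕ) : ℝ) / q) ^ (k : ℕ) : ℝ) :=
    (summable_choose_mul_geometric_of_norm_lt_one m hr).subtype _
  have h2 := (summable_natCast_rpow_Ici (c := β - (s.re + 1)) (by linarith) n₀).mul_left K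
  refine Summable.of_norm_bounded (h1.mul_of_nonneg h2 (fun k => by positivity)
    fun n => by positivity) fun p => ?_
  have hk : (1 : ℝ) ≤ (p.1 : ℕ) := by exact_mod_cast p.1.2
  rw [norm_smul, norm_mul, norm_pow, norm_div, Complex.norm_natCast, Complex.norm_natCast]
  gcongr
  · exact norm_choose_neg_le hm _
  · exact norm_dirichletTerm_le hq hf (hn₀.trans p.2.2) (by simpa using hk)

theorem binomTerm_eq_tsum (hq : 2 ≤ q) (r : Fin q) (s : ℂ) (k : ℕ) :
    binomTerm hq A n₀ r k s = ∑' n : Set.Ici n₀,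
      (Ring.choose (-s) k * (((r : ℕ) : ℂ) / (q : ℂ)) ^ k * ((n : ℕ) : ℂ) ^ (-(s + k))) •
        matSeq hq A n := by
  rw [binomTerm, dirichletSeries, ← tsum_const_smul'']
  exact tsum_congr fun n => by rw [dirichletTerm, smul_smul]

theorem hasSum_binomTerm_swap (hN : ∀ x : Fin d → ℂ, N x = 0 → x = 0) (hq : 2 ≤ q)
    (hn₀ : 1 ≤ n₀) (r : Fin q) {s : ℂ}
    (hs : s ∈ halfPlane (logq q (jointSpectralRadius N A))) :
    HasSum (fun n : Set.Ici n₀ => (((n : ℕ) : ℂ) ^ (-s)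
      * ((1 + ((r : ℕ) : ℂ) / q / (n : ℕ)) ^ (-s) - 1)) • matSeq hq A n)
      (∑' k : Set.Ici 1, binomTerm hq A n₀ r k s) := by
  have h := hasSum_smul_of_summable_prod (E := Mat d)
    (c := fun (k : Set.Ici 1) (n : Set.Ici n₀) => Ring.choose (-s) (k : ℕ)
      * (((r : ℕ) : ℂ) / (q : ℂ)) ^ (k : ℕ) * ((n : ℕ) : ℂ) ^ (-(s + (k : ℕ))))
    (v := fun n : Set.Ici n₀ => matSeq hq A n)
    (g := fun n : Set.Ici n₀ => (((n : ℕ) : ℂ) ^ (-s)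
      * ((1 + ((r : ℕ) : ℂ) / q / (n : ℕ)) ^ (-s) - 1)))
  have h1 := h ?_ fun n => hasSum_binom_sub_one r.2 (hn₀.trans n.2) s
  · simp only [binomTerm_eq_tsum]
    exact h1
  · have hsum := summable_binom_dirichletTerm (A := A) hN hq hn₀ r hs
    simp only [dirichletTerm, smul_smul] at hsum
    exact hsum

theorem hasSum_shiftDiff (hN : ∀ x : Fin d → ℂ, N x = 0 → x = 0) (hq : 2 ≤ q)
    (hn₀ : 1 ≤ n₀) (r : Fin q) {s : ℂ}
    (hs : s ∈ halfPlane (logq q (jointSpectralRadius N A))) :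
    HasSum (fun n : Set.Ici n₀ => shiftDiff q r n s • matSeq hq A n)
      ((q : ℂ) ^ (-s) • ∑' k : Set.Ici 1, binomTerm hq A n₀ r k s) := by
  have e : (fun n : Set.Ici n₀ => shiftDiff q r n s • matSeq hq A n) = fun n : Set.Ici n₀ =>
      (q : ℂ) ^ (-s) • (((n : ℕ) : ℂ) ^ (-s)
        * ((1 + ((r : ℕ) : ℂ) / q / (n : ℕ)) ^ (-s) - 1)) • matSeq hq A n :=
    funext fun n => by rw [shiftDiff_eq (by omega) (hn₀.trans n.2), mul_smul]
  rw [e]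
  exact (hasSum_binomTerm_swap hN hq hn₀ r hs).const_smul ((q : ℂ) ^ (-s))

/-- Writes G with series over n instead of k. This form matches the residue splitting in the
functional equation and yields the vertical growth bound, for which the termwise estimates in k are
too crude. -/
theorem inhomogeneity_eq (hN : ∀ x : Fin d → ℂ, N x = 0 → x = 0) (hq : 2 ≤ q)
    (hn₀ : 1 ≤ n₀) {s : ℂ} (hs : s ∈ halfPlane (logq q (jointSpectralRadius N A))) :
    inhomogeneity hq A n₀ s = ∑ n ∈ Finset.Ico n₀ (q * n₀), dirichletTerm hq A n s
      + ∑ r : Fin q, A r * ∑' n : Set.Ici n₀, shiftDiff q r n s • matSeq hq A n := by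
  rw [inhomogeneity, Finset.smul_sum]
  congr 1
  refine Finset.sum_congr rfl fun r _ => ?_
  rw [(hasSum_shiftDiff hN hq hn₀ r hs).tsum_eq, Matrix.mul_smul]

theorem tsum_Ici_eq_sum_add_tsum {E : Type*} [NormedAddCommGroup E] [CompleteSpace E]
    {q n₀ : ℕ} (hq : 1 ≤ q) {g : ℕ → E} (hg : Summable fun n : Set.Ici n₀ => g n) :
    ∑' n : Set.Ici n₀, g n = ∑ n ∈ Finset.Ico n₀ (q * n₀), g n
      + ∑ r : Fin q, ∑' n : Set.Ici n₀, g (q * n + r) := by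
  have : NeZero q := ⟨by omega⟩
  have hle : n₀ ≤ q * n₀ := Nat.le_mul_of_pos_left n₀ hq
  have hG : Summable ((Set.Ici n₀).indicator g) := summable_subtype_iff_indicator.1 hg
  have hH : Summable ((Set.Ici (q * n₀)).indicator g) := by
    have := hG.indicator (Set.Ici (q * n₀))
    rwa [Set.indicator_indicator, Set.inter_eq_left.2 (Set.Ici_subset_Ici.2 hle)] at this
  have h1 : (Set.Ici n₀).indicator g = fun n => (Finset.Ico n₀ (q * n₀) : Set ℕ).indicator g n
      + (Set.Ici (q * n₀)).indicator g n := by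
    funext n
    simp only [Set.indicator_apply, Set.mem_Ici, Finset.coe_Ico, Set.mem_Ico]
    split_ifs <;> first | omega | simp
  have h2 : ∀ p : ℕ × Fin q, (Set.Ici (q * n₀)).indicator g ((Nat.divModEquiv q).symm p)
      = (Set.Ici n₀).indicator (fun n => g (q * n + p.2)) p.1 := by
    rintro ⟨n, r⟩
    have h3 : (Nat.divModEquiv q).symm (n, r) = q * n + r := by
      rw [mul_comm]; rfl
    -- Division with remainder therefore maps the tail n ≥ q n₀ onto all pairs (n, r) with n ≥ n₀.
    have h4 : q * n₀ ≤ q * n + r ↔ n₀ ≤ n := by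
      constructor
      · intro h
        have h5 : q * n₀ < q * (n + 1) := by rw [mul_add_one]; have := r.2; omega
        exact Nat.lt_succ_iff.1 (Nat.lt_of_mul_lt_mul_left h5)
      · intro h
        exact (Nat.mul_le_mul_left q h).trans (Nat.le_add_right _ _)
    rw [h3]
    simp only [Set.indicator_apply, Set.mem_Ici, h4]
  have h5 : Summable fun p : Fin q × ℕ =>
      (Set.Ici n₀).indicator (fun n => g (q * n + p.1)) p.2 := by
    have := (Nat.divModEquiv q).symm.summable_iff.2 hH
    have := (Equiv.prodComm (Fin q) ℕ).summable_iff.2 this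
    exact this.congr fun p => h2 (p.2, p.1)
  rw [tsum_subtype, h1, Summable.tsum_add (summable_of_hasFiniteSupport
    ((Finset.finite_toSet _).subset Set.support_indicator_subset)) hH, ← sum_eq_tsum_indicator,
    ← (Nat.divModEquiv q).symm.tsum_eq, tsum_congr h2, ← (Equiv.prodComm (Fin q) ℕ).tsum_eq]
  congr 1
  simp only [Equiv.prodComm_apply, Prod.fst_swap, Prod.snd_swap]
  rw [h5.tsum_prod, tsum_fintype]
  exact Finset.sum_congr rfl fun r _ => (tsum_subtype _ _).symm

theorem halfPlane_add_one_subset (α : EReal) : halfPlane (α + 1) ⊆ halfPlane α :=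
  fun s (hs : α + 1 < (s.re : EReal)) => show α < (s.re : EReal) from
    lt_of_le_of_lt (le_add_of_nonneg_right zero_le_one) hs

theorem functional_equation (hN : ∀ x : Fin d → ℂ, N x = 0 → x = 0) (hq : 2 ≤ q)
    (hn₀ : 1 ≤ n₀) {s : ℂ} (hs : s ∈ halfPlane (logq q (jointSpectralRadius N A) + 1)) :
    (1 - (q : ℂ) ^ (-s) • sumMat A) * dirichletSeries hq A n₀ s = inhomogeneity hq A n₀ s := by
  have hs' := halfPlane_add_one_subset _ hs
  have hF := (dirichletTerm_locallyDominated (A := A) hN hq hn₀).summable hs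
  have hn : ∀ n : Set.Ici n₀, (n : ℕ) ≠ 0 := fun n =>
    (Nat.lt_of_lt_of_le hn₀ n.2).ne'
  have h1 : ∀ (r : Fin q) (n : Set.Ici n₀), dirichletTerm hq A (q * n + r) s
      = A r * (((q * n + r : ℕ) : ℂ) ^ (-s) • matSeq hq A n) := fun r n => by
    have := hn n
    rw [dirichletTerm, matSeq_rec hq A n r (by positivity), Matrix.mul_smul]
  have h2 : Summable fun n : Set.Ici n₀ => ((q * n : ℕ) : ℂ) ^ (-s) • matSeq hq A n := by
    refine (hF.const_smul ((q : ℂ) ^ (-s))).congr fun n => ?_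
    rw [dirichletTerm, smul_smul, Nat.cast_mul, Complex.natCast_mul_natCast_cpow]
  have h2' : ∑' n : Set.Ici n₀, ((q * n : ℕ) : ℂ) ^ (-s) • matSeq hq A n
      = (q : ℂ) ^ (-s) • dirichletSeries hq A n₀ s := by
    rw [dirichletSeries, ← tsum_const_smul'']
    refine tsum_congr fun n => ?_
    rw [dirichletTerm, smul_smul, Nat.cast_mul, Complex.natCast_mul_natCast_cpow]
  -- Summability is inherited from the difference to the case r = 0, avoiding a separate estimate.
  have h3 : ∀ r : Fin q,
      Summable fun n : Set.Ici n₀ => ((q * n + r : ℕ) : ℂ) ^ (-s) • matSeq hq A n := fun r => by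
    refine ((hasSum_shiftDiff hN hq hn₀ r hs').summable.add h2).congr fun n => ?_
    rw [shiftDiff, sub_smul, sub_add_cancel]
  have h4 : dirichletSeries hq A n₀ s = ∑ n ∈ Finset.Ico n₀ (q * n₀), dirichletTerm hq A n s
      + ∑ r : Fin q, A r * ∑' n : Set.Ici n₀, ((q * n + r : ℕ) : ℂ) ^ (-s) • matSeq hq A n := by
    refine (tsum_Ici_eq_sum_add_tsum (g := fun n => dirichletTerm hq A n s)
      (by omega : 1 ≤ q) hF).trans ?_
    congr 1
    exact Finset.sum_congr rfl fun r _ => (tsum_congr (h1 r)).trans ((h3 r).tsum_mul_left (A r))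
  have h5 : ∀ r : Fin q, ∑' n : Set.Ici n₀, shiftDiff q r n s • matSeq hq A n
      = ∑' n : Set.Ici n₀, ((q * n + r : ℕ) : ℂ) ^ (-s) • matSeq hq A n
        - (q : ℂ) ^ (-s) • dirichletSeries hq A n₀ s := fun r => by
    rw [← h2', ← (h3 r).tsum_sub h2]
    exact tsum_congr fun n => by rw [shiftDiff, sub_smul]
  rw [inhomogeneity_eq hN hq hn₀ hs']
  simp only [h5, mul_sub, Finset.sum_sub_distrib]
  rw [← add_sub_assoc, ← h4, sub_mul, one_mul, smul_mul_assoc, ← Finset.sum_mul, mul_smul_comm]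
  rfl

end FunctionalEquation

open Polynomial

/-! ### The resolvent via the minimal polynomial. -/

section Resolvent

variable {d : ℕ}

/-- The matrix polynomial `h(μ, C)` with `(μ - C) h(μ, C) = p(μ) - p(C)`. -/
def divDiff (C : Mat d) (p : ℂ[X]) (μ : ℂ) : Mat d :=
  ∑ i ∈ Finset.range (p.natDegree + 1), p.coeff i •
    ∑ j ∈ Finset.range i, (μ • (1 : Mat d)) ^ j * C ^ (i - 1 - j)

theorem sub_mul_divDiff (C : Mat d) (p : ℂ[X]) (μ : ℂ) :
    (μ • 1 - C) * divDiff C p μ = p.eval μ • 1 - aeval C p := by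
  have hcomm : Commute (μ • (1 : Mat d)) C := (Commute.one_left C).smul_left μ
  rw [divDiff, Finset.mul_sum, aeval_eq_sum_range, eval_eq_sum_range, Finset.sum_smul,
    ← Finset.sum_sub_distrib]
  refine Finset.sum_congr rfl fun i _ => ?_
  rw [mul_smul_comm, hcomm.mul_geom_sum₂, smul_sub, _root_.smul_pow, one_pow, smul_smul]

theorem differentiable_divDiff (C : Mat d) (p : ℂ[X]) : Differentiable ℂ (divDiff C p) := by
  unfold divDiff
  simp only [_root_.smul_pow, one_pow, smul_mul_assoc, one_mul]
  fun_prop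

theorem mem_spectrum_of_eval_minpoly_eq_zero {C : Mat d} {μ : ℂ}
    (h : (minpoly ℂ C).eval μ = 0) : μ ∈ spectrum ℂ C := by
  rw [← Matrix.spectrum_toLin', ← Module.End.hasEigenvalue_iff_mem_spectrum]
  refine Module.End.hasEigenvalue_of_isRoot ?_
  rwa [Matrix.minpoly_toLin']

end Resolvent

/-! ### Root multiplicity in the minimal polynomial as a Jordan block size. -/

section Jordan

variable {V : Type*} [AddCommGroup V] [Module ℂ V] [FiniteDimensional ℂ V]

/-- The chain v, …, T^{k-1} v spans a T-invariant subspace, and the common kernel of φ ∘ T^i, i < k,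
is a T-invariant complement: the pairing φ(T^{i+k-1-j} v) is triangular with nonzero diagonal. -/
theorem exists_basis_nilpotent_chain {k : ℕ} (T : V →ₗ[ℂ] V) (φ : V →ₗ[ℂ] ℂ) (v : V)
    (hv : (T ^ k) v = 0) (hφ : ∀ w, φ ((T ^ k) w) = 0) (h : φ ((T ^ (k - 1)) v) ≠ 0) :
    ∃ (m : ℕ) (b : Module.Basis (Fin k ⊕ Fin m) ℂ V) (W : Matrix (Fin m) (Fin m) ℂ),
      LinearMap.toMatrix b b T = fromBlocks (jordanBlock k 0) 0 0 W := by
  have hv' : ∀ n, k ≤ n → (T ^ n) v = 0 := fun n hn => by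
    rw [← Nat.sub_add_cancel hn, pow_add, Module.End.mul_apply, hv, map_zero]
  let Φ : V →ₗ[ℂ] (Fin k → ℂ) := LinearMap.pi fun i => φ ∘ₗ (T ^ (i : ℕ))
  -- The chain runs backwards, so T sends each vector to its predecessor, as the superdiagonal ones
  -- of `jordanBlock` require.
  let Γ : (Fin k → ℂ) →ₗ[ℂ] V := Fintype.linearCombination ℂ fun j : Fin k => (T ^ (k - 1 - j)) v
  have hΓ : ∀ j : Fin k, Γ (Pi.single j 1) = (T ^ (k - 1 - j)) v := fun j => by
    simp [Γ, Fintype.linearCombination_apply_single]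
  have hΨ : Function.Injective (Φ ∘ₗ Γ) := by
    rw [injective_iff_map_eq_zero]
    intro c hc
    have hsum : ∀ i : Fin k, ∑ j : Fin k, c j * φ ((T ^ ((i : ℕ) + (k - 1 - j))) v) = 0 := by
      intro i
      have h1 : φ ((T ^ (i : ℕ)) (Γ c)) = 0 := congrFun hc i
      rw [show Γ c = ∑ j, c j • (T ^ (k - 1 - j)) v from rfl, map_sum, map_sum] at h1
      rw [← h1]
      refine Finset.sum_congr rfl fun j _ => ?_
      rw [map_smul, map_smul, smul_eq_mul, pow_add, Module.End.mul_apply]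
    -- Back substitution from the last coordinate: coefficients with j > i are already zero, and for
    -- j < i the power of T is at least k.
    have hzero : ∀ n, ∀ i : Fin k, k - 1 - i = n → c i = 0 := by
      intro n
      induction n using Nat.strong_induction_on with
      | _ n ih =>
        intro i hi
        have h1 := hsum i
        rw [Finset.sum_eq_single i] at h1
        · rw [show (i : ℕ) + (k - 1 - i) = k - 1 by omega] at h1
          exact (mul_eq_zero.1 h1).resolve_right h
        · intro j _ hj
          have hj' : (j : ℕ) ≠ i := fun h => hj (Fin.ext h)
          rcases lt_or_ge (i : ℕ) j with hij | hij
          · rw [ih (k - 1 - j) (by omega) j rfl, zero_mul]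
          · rw [hv' _ (by omega), map_zero, mul_zero]
        · simp
    exact funext fun i => hzero _ i rfl
  have hΨs : Function.Surjective (Φ ∘ₗ Γ) := LinearMap.surjective_of_injective hΨ
  let L : (Fin k → ℂ) × LinearMap.ker Φ →ₗ[ℂ] V := Γ.coprod (LinearMap.ker Φ).subtype
  have hL : Function.Bijective L := by
    constructor
    · rw [injective_iff_map_eq_zero]
      rintro ⟨c, w⟩ hcw
      have h1 : Γ c + w = 0 := hcw
      have h2 : (Φ ∘ₗ Γ) c = 0 := by
        have := congrArg Φ h1
        rwa [map_add, w.2, add_zero, map_zero] at this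
      have hc := (injective_iff_map_eq_zero _).1 hΨ c h2
      subst hc
      rw [map_zero, zero_add] at h1
      ext1
      · rfl
      · exact Subtype.ext h1
    · intro x
      obtain ⟨c, hc⟩ := hΨs (Φ x)
      refine ⟨(c, ⟨x - Γ c, ?_⟩), ?_⟩
      · rw [LinearMap.mem_ker, map_sub, ← hc]
        simp
      · simp [L]
  let e := LinearEquiv.ofBijective L hL
  let b := ((Pi.basisFun ℂ (Fin k)).prod (Module.finBasis ℂ (LinearMap.ker Φ))).map e
  have hbl : ∀ j, b (Sum.inl j) = (T ^ (k - 1 - j)) v := fun j => by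
    simp [b, e, L, hΓ]
  have hbr : ∀ j, b (Sum.inr j) = (Module.finBasis ℂ (LinearMap.ker Φ) j : V) := fun j => by
    simp [b, e, L]
  refine ⟨_, b, (LinearMap.toMatrix b b T).toBlocks₂₂, ?_⟩
  have hinl : ∀ j : Fin k, ∀ x, b.repr (T (b (Sum.inl j))) x =
      fromBlocks (jordanBlock k 0) 0 0 (LinearMap.toMatrix b b T).toBlocks₂₂ x (Sum.inl j) := by
    intro j x
    rw [hbl, ← Module.End.mul_apply, ← pow_succ']
    by_cases hj : (j : ℕ) = 0
    · rw [hv' _ (by omega)]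
      rcases x with i | i
      · simp [jordanBlock, hj]
      · simp
    · have h1 : (T ^ (k - 1 - (j : ℕ) + 1)) v = b (Sum.inl ⟨j - 1, by omega⟩) := by
        rw [hbl]
        congr 2
        simp only
        omega
      rw [h1, b.repr_self]
      rcases x with i | i
      · simp only [fromBlocks_apply₁₁, jordanBlock, Matrix.of_apply, Finsupp.single_apply,
          Sum.inl.injEq, Fin.ext_iff]
        have := i.2
        split_ifs <;> first | rfl | omega
      · simp
  have hinr : ∀ j i, b.repr (T (b (Sum.inr j))) (Sum.inl i) = 0 := by
    intro j i
    have hw := (Module.finBasis ℂ (LinearMap.ker Φ) j).2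
    rw [hbr]
    set w := (Module.finBasis ℂ (LinearMap.ker Φ) j : V)
    have hTw : T w ∈ LinearMap.ker Φ := by
      rw [LinearMap.mem_ker] at hw ⊢
      funext i
      change φ ((T ^ (i : ℕ)) (T w)) = 0
      rw [← Module.End.mul_apply, ← pow_succ]
      -- T shifts the coordinates of Φ; the one shifted in at the end is φ(T^k w), which vanishes by
      -- `hφ`.
      by_cases hi : (i : ℕ) + 1 = k
      · rw [hi, hφ]
      · exact congrFun hw ⟨i + 1, by omega⟩
    have h1 : e.symm (T w) = (0, ⟨T w, hTw⟩) := by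
      rw [LinearEquiv.symm_apply_eq]
      simp [e, L]
    simp [b, h1]
  ext x y
  rw [LinearMap.toMatrix_apply]
  rcases y with j | j
  · exact hinl j x
  · rcases x with i | i
    · rw [hinr]; simp
    · simp [toBlocks₂₂, LinearMap.toMatrix_apply]

theorem hasJordanBlock_of_basis {d k m : ℕ} {C : Mat d} {lam : ℂ}
    (b : Module.Basis (Fin k ⊕ Fin m) ℂ (Fin d → ℂ)) {W : Matrix (Fin m) (Fin m) ℂ}
    (h : LinearMap.toMatrix b b (Matrix.toLin' (C - lam • 1))
      = fromBlocks (jordanBlock k 0) 0 0 W) :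
    HasJordanBlock C lam k := by
  have hcard : Fintype.card (Fin d) = Fintype.card (Fin k ⊕ Fin m) := by
    rw [← Module.finrank_eq_card_basis b, ← Module.finrank_eq_card_basis (Pi.basisFun ℂ (Fin d))]
  let e := Fintype.equivOfCardEq hcard
  let b' := b.reindex e.symm
  let s := Pi.basisFun ℂ (Fin d)
  have hTT : b'.toMatrix s * s.toMatrix b' = 1 := Module.Basis.toMatrix_mul_toMatrix_flip _ _
  refine ⟨m, e, b'.toMatrix s, W + lam • 1, .of_mul_eq_one _ hTT, ?_⟩
  rw [Matrix.inv_eq_right_inv hTT]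
  have hC : LinearMap.toMatrix b b (Matrix.toLin' C)
      = fromBlocks (jordanBlock k lam) 0 0 (W + lam • 1) := by
    have h1 : Matrix.toLin' C = Matrix.toLin' (C - lam • 1) + lam • LinearMap.id := by
      rw [map_sub, map_smul, Matrix.toLin'_one]; simp
    rw [h1, map_add, h, map_smul, LinearMap.toMatrix_id, ← fromBlocks_one, fromBlocks_smul,
      fromBlocks_add]
    congr 1
    · ext i j
      simp only [jordanBlock, Matrix.add_apply, Matrix.of_apply, Matrix.smul_apply,
        Matrix.one_apply]
      by_cases hij : i = j
      · simp [hij]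
      · simp [hij]
    · simp
    · simp
  have h2 := basis_toMatrix_mul_linearMap_toMatrix_mul_basis_toMatrix b' s b' s (Matrix.toLin' C)
  rw [show LinearMap.toMatrix s s (Matrix.toLin' C) = C by
    rw [LinearMap.toMatrix_eq_toMatrix', LinearMap.toMatrix'_toLin']] at h2
  rw [h2, ← hC]
  ext i j
  simp [b', LinearMap.toMatrix_apply]

/-- Write the minimal polynomial as (X - λ)^k g with g(λ) ≠ 0. Take v = g(C) e_j and φ(w) = (g(C)
w)_i. Both are killed by (C - λ)^k, and φ((C - λ)^{k-1} v) is an entry of (C - λ)^{k-1} g(C)². That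
matrix is nonzero, as the minimal polynomial does not divide (X - λ)^{k-1} g². -/
theorem hasJordanBlock_rootMultiplicity {d : ℕ} (C : Mat d) {lam : ℂ}
    (hlam : (minpoly ℂ C).rootMultiplicity lam ≠ 0) :
    HasJordanBlock C lam ((minpoly ℂ C).rootMultiplicity lam) := by
  have hp : minpoly ℂ C ≠ 0 := minpoly.ne_zero (Matrix.isIntegral C)
  set k := (minpoly ℂ C).rootMultiplicity lam with hk
  obtain ⟨g, hg, hdvd⟩ := exists_eq_pow_rootMultiplicity_mul_and_not_dvd _ hp lam
  rw [← hk] at hg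
  have hq : aeval C ((X - Polynomial.C lam) ^ (k - 1) * (g * g)) ≠ 0 := by
    intro h0
    have h1 := minpoly.dvd ℂ C h0
    have h2 : (X - Polynomial.C lam) ^ (k - 1) * (X - Polynomial.C lam)
        ∣ (X - Polynomial.C lam) ^ (k - 1) * (g * g) := by
      rw [← pow_succ, Nat.sub_add_cancel (Nat.one_le_iff_ne_zero.2 hlam)]
      exact (Dvd.intro _ hg.symm).trans h1
    have h3 := (mul_dvd_mul_iff_left (pow_ne_zero _ (X_sub_C_ne_zero lam))).1 h2
    exact ((prime_X_sub_C lam).dvd_or_dvd h3).elim hdvd hdvd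
  obtain ⟨i, j, hij⟩ : ∃ i j, aeval C ((X - Polynomial.C lam) ^ (k - 1) * (g * g)) i j ≠ 0 := by
    by_contra! h0
    exact hq (Matrix.ext h0)
  have hT : ∀ n w, ((Matrix.toLin' (C - lam • 1)) ^ n) w
      = aeval C ((X - Polynomial.C lam) ^ n) *ᵥ w := fun n w => by
    rw [← Matrix.toLin'_pow, Matrix.toLin'_apply]
    simp [Algebra.algebraMap_eq_smul_one]
  have hp0 : aeval C ((X - Polynomial.C lam) ^ k * g) = 0 := by rw [← hg]; exact minpoly.aeval ℂ C
  obtain ⟨m, b, W, hb⟩ := exists_basis_nilpotent_chain (k := k) (Matrix.toLin' (C - lam • 1))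
    (LinearMap.proj i ∘ₗ Matrix.toLin' (aeval C g)) (aeval C g *ᵥ Pi.single j 1)
    (by rw [hT, mulVec_mulVec, ← map_mul, hp0, zero_mulVec])
    (fun w => by
      rw [hT, LinearMap.comp_apply, Matrix.toLin'_apply, mulVec_mulVec, ← map_mul, mul_comm, hp0]
      simp)
    (by
      rw [hT, LinearMap.comp_apply, Matrix.toLin'_apply, mulVec_mulVec, mulVec_mulVec, ← map_mul,
        ← map_mul]
      rw [show g * (X - Polynomial.C lam) ^ (k - 1) * g
        = (X - Polynomial.C lam) ^ (k - 1) * (g * g) by ring]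
      simpa using hij)
  exact hasJordanBlock_of_basis b hb

theorem rootMultiplicity_le_maxJordanSize {d : ℕ} (C : Mat d) (lam : ℂ) :
    (minpoly ℂ C).rootMultiplicity lam ≤ maxJordanSize C lam := by
  by_cases h : (minpoly ℂ C).rootMultiplicity lam = 0
  · omega
  · refine le_csSup ⟨d, ?_⟩ (hasJordanBlock_rootMultiplicity C h)
    rintro m ⟨k, e, -⟩
    have := Fintype.card_congr e
    simp at this
    omega

end Jordan

/-! ### The meromorphic continuation and its poles. -/

section Continuation

variable {q d : ℕ} {N : Seminorm ℂ (Fin d → ℂ)} {A : Fin q → Mat d} {n₀ : ℕ}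

/-- The matrix `μ (μ - C)⁻¹`, written as a quotient with denominator the minimal polynomial. -/
def scaledResolvent (C : Mat d) (μ : ℂ) : Mat d :=
  (μ / (minpoly ℂ C).eval μ) • divDiff C (minpoly ℂ C) μ

theorem mul_scaledResolvent {C : Mat d} {μ : ℂ} (hμ : μ ≠ 0)
    (h : (minpoly ℂ C).eval μ ≠ 0) : (1 - μ⁻¹ • C) * scaledResolvent C μ = 1 := by
  have h1 : (1 : Mat d) - μ⁻¹ • C = μ⁻¹ • (μ • 1 - C) := by
    rw [smul_sub, smul_smul, inv_mul_cancel₀ hμ, one_smul]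
  rw [h1, scaledResolvent, smul_mul_assoc, mul_smul_comm, sub_mul_divDiff, minpoly.aeval,
    sub_zero, smul_smul, smul_smul]
  rw [mul_assoc, div_mul_cancel₀ _ h, inv_mul_cancel₀ hμ, one_smul]

/-- The continuation `(I - q^{-s} C)⁻¹ G(s)` of the Dirichlet series. -/
def continuation (hq : 2 ≤ q) (A : Fin q → Mat d) (n₀ : ℕ) (s : ℂ) : Mat d :=
  scaledResolvent (sumMat A) ((q : ℂ) ^ s) * inhomogeneity hq A n₀ s

theorem natCast_ne_zero_of_two_le (hq : 2 ≤ q) : (q : ℂ) ≠ 0 := by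
  exact_mod_cast (by omega : q ≠ 0)

theorem natCast_cpow_ne_zero (hq : 2 ≤ q) (s : ℂ) : (q : ℂ) ^ s ≠ 0 := by
  simp [Complex.cpow_eq_zero_iff, natCast_ne_zero_of_two_le hq]

theorem sub_mul_continuation (hq : 2 ≤ q) {s : ℂ}
    (h : (minpoly ℂ (sumMat A)).eval ((q : ℂ) ^ s) ≠ 0) :
    (1 - (q : ℂ) ^ (-s) • sumMat A) * continuation hq A n₀ s = inhomogeneity hq A n₀ s := by
  rw [continuation, ← mul_assoc, Complex.cpow_neg,
    mul_scaledResolvent (natCast_cpow_ne_zero hq s) h, one_mul]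

/-- A root q^s would be an eigenvalue of modulus at most q^{β+1} for some β with β + 1 < Re s, while
its modulus is q^{Re s}. -/
theorem eval_minpoly_ne_zero (hN : ∀ x : Fin d → ℂ, N x = 0 → x = 0) (hq : 2 ≤ q) {s : ℂ}
    (hs : s ∈ halfPlane (logq q (jointSpectralRadius N A) + 1)) :
    (minpoly ℂ (sumMat A)).eval ((q : ℂ) ^ s) ≠ 0 := by
  intro h
  obtain ⟨β, hβ₁, hβ₂⟩ := EReal.lt_iff_exists_real_btwn.1 (lt_sub_one_of_add_one_lt hs)
  have hβ₂' : β < s.re - 1 := by exact_mod_cast hβ₂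
  have h1 := norm_le_of_mem_spectrum_sumMat hN
    (lt_rpow_of_logq_lt hq jointSpectralRadius_nonneg hβ₁) (mem_spectrum_of_eval_minpoly_eq_zero h)
  have hq1 : (1 : ℝ) < q := by exact_mod_cast (by omega : 1 < q)
  rw [Complex.norm_natCast_cpow_of_pos (by omega), mul_comm,
    ← Real.rpow_add_one (by positivity)] at h1
  have h2 := (Real.rpow_le_rpow_left_iff hq1).1 h1
  linarith

theorem continuation_eq (hN : ∀ x : Fin d → ℂ, N x = 0 → x = 0) (hq : 2 ≤ q) (hn₀ : 1 ≤ n₀)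
    {s : ℂ} (hs : s ∈ halfPlane (logq q (jointSpectralRadius N A) + 1)) :
    continuation hq A n₀ s = dirichletSeries hq A n₀ s := by
  have h1 := mul_scaledResolvent (natCast_cpow_ne_zero hq s) (eval_minpoly_ne_zero (A := A) hN hq hs)
  rw [← Complex.cpow_neg] at h1
  rw [continuation, ← functional_equation hN hq hn₀ hs, ← mul_assoc, mul_eq_one_comm.1 h1, one_mul]

theorem eq_polePoint (hq : 2 ≤ q) (s : ℂ) : ∃ l : ℤ, s = polePoint q ((q : ℂ) ^ s) l := by
  have hlog : (Real.log q : ℂ) ≠ 0 := by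
    exact_mod_cast (Real.log_pos (by exact_mod_cast (by omega : 1 < q))).ne'
  have h1 : Complex.exp (s * Real.log q) = Complex.exp (Complex.log ((q : ℂ) ^ s)) := by
    rw [Complex.exp_log (natCast_cpow_ne_zero hq s),
      Complex.cpow_def_of_ne_zero (natCast_ne_zero_of_two_le hq), mul_comm, ← Complex.natCast_log]
  obtain ⟨l, hl⟩ := Complex.exp_eq_exp_iff_exists_int.1 h1
  refine ⟨l, ?_⟩
  rw [polePoint, ← add_div, eq_div_iff hlog, hl]
  ring

theorem cpow_polePoint (hq : 2 ≤ q) {lam : ℂ} (hlam : lam ≠ 0) (l : ℤ) :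
    (q : ℂ) ^ polePoint q lam l = lam := by
  have hlog : (Real.log q : ℂ) ≠ 0 := by
    exact_mod_cast (Real.log_pos (by exact_mod_cast (by omega : 1 < q))).ne'
  rw [Complex.cpow_def_of_ne_zero (natCast_ne_zero_of_two_le hq), polePoint, ← add_div,
    ← Complex.natCast_log, mul_div_cancel₀ _ hlog, Complex.exp_add, Complex.exp_log hlam,
    show 2 * (Real.pi : ℂ) * Complex.I * l = l * (2 * Real.pi * Complex.I) by ring,
    Complex.exp_int_mul_two_pi_mul_I, mul_one]

theorem lt_norm_cpow (hq : 2 ≤ q) {ρ : ℝ} (hρ : 0 ≤ ρ) {s : ℂ} (hs : s ∈ halfPlane (logq q ρ)) :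
    ρ < ‖(q : ℂ) ^ s‖ := by
  rw [Complex.norm_natCast_cpow_of_pos (by omega)]
  exact lt_rpow_of_logq_lt hq hρ hs

theorem polePoint_mem_halfPlane (hq : 2 ≤ q) {ρ : ℝ} (hρ : 0 ≤ ρ) {lam : ℂ} (hlam : ρ < ‖lam‖)
    (l : ℤ) : polePoint q lam l ∈ halfPlane (logq q ρ) := by
  refine logq_lt_of_lt_rpow hq hρ ?_
  rw [← Complex.norm_natCast_cpow_of_pos (by omega), cpow_polePoint hq _ l]
  · exact hlam
  · exact norm_pos_iff.1 (hρ.trans_lt hlam)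

theorem differentiable_natCast_cpow (hq : 2 ≤ q) : Differentiable ℂ fun s : ℂ => (q : ℂ) ^ s :=
  fun _ => differentiableAt_id.const_cpow (Or.inl (natCast_ne_zero_of_two_le hq))

theorem deriv_natCast_cpow_ne_zero (hq : 2 ≤ q) (s : ℂ) :
    deriv (fun s : ℂ => (q : ℂ) ^ s) s ≠ 0 := by
  have h := (hasDerivAt_id s).const_cpow (c := (q : ℂ)) (Or.inl (natCast_ne_zero_of_two_le hq))
  have hlog : Complex.log q ≠ 0 := by
    rw [← Complex.natCast_log]
    exact_mod_cast (Real.log_pos (by exact_mod_cast (by omega : 1 < q))).ne'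
  rw [show deriv (fun s : ℂ => (q : ℂ) ^ s) s = _ from h.deriv]
  simpa [hlog] using natCast_cpow_ne_zero hq s

theorem analyticAt_eval_cpow (hq : 2 ≤ q) (p : ℂ[X]) (s : ℂ) :
    AnalyticAt ℂ (fun z => p.eval ((q : ℂ) ^ z)) s :=
  (p.differentiable.comp (differentiable_natCast_cpow hq)).analyticAt s

theorem analyticAt_divDiff_mul_inhomogeneity (hN : ∀ x : Fin d → ℂ, N x = 0 → x = 0)
    (hq : 2 ≤ q) (hn₀ : 1 ≤ n₀) {s : ℂ}
    (hs : s ∈ halfPlane (logq q (jointSpectralRadius N A))) (i j : Fin d) :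
    AnalyticAt ℂ (fun z => (divDiff (sumMat A) (minpoly ℂ (sumMat A)) ((q : ℂ) ^ z)
      * inhomogeneity hq A n₀ z) i j) s := by
  simp only [Matrix.mul_apply]
  refine Finset.analyticAt_fun_sum _ fun k _ => .fun_mul ?_ ?_
  · have h := (differentiable_divDiff (sumMat A) (minpoly ℂ (sumMat A))).comp
      (differentiable_natCast_cpow hq)
    exact (differentiable_pi.1 (differentiable_pi.1 h i) k).analyticAt s
  · exact analyticOnNhd_entry (differentiableOn_inhomogeneity hN hq hn₀) k j s hs

theorem continuation_apply (hq : 2 ≤ q) (s : ℂ) (i j : Fin d) :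
    continuation hq A n₀ s i j = (q : ℂ) ^ s / (minpoly ℂ (sumMat A)).eval ((q : ℂ) ^ s) *
      (divDiff (sumMat A) (minpoly ℂ (sumMat A)) ((q : ℂ) ^ s) * inhomogeneity hq A n₀ s) i j := by
  rw [continuation, scaledResolvent, smul_mul_assoc, Matrix.smul_apply, smul_eq_mul]

theorem meromorphicAt_continuation (hN : ∀ x : Fin d → ℂ, N x = 0 → x = 0)
    (hq : 2 ≤ q) (hn₀ : 1 ≤ n₀) {s : ℂ}
    (hs : s ∈ halfPlane (logq q (jointSpectralRadius N A))) (i j : Fin d) :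
    MeromorphicAt (fun z => continuation hq A n₀ z i j) s := by
  simp only [continuation_apply]
  exact (((differentiable_natCast_cpow hq).analyticAt s).meromorphicAt.fun_div
    (analyticAt_eval_cpow hq _ s).meromorphicAt).fun_mul
    (analyticAt_divDiff_mul_inhomogeneity hN hq hn₀ hs i j).meromorphicAt

theorem analyticAt_continuation (hN : ∀ x : Fin d → ℂ, N x = 0 → x = 0)
    (hq : 2 ≤ q) (hn₀ : 1 ≤ n₀) {s : ℂ}
    (hs : s ∈ halfPlane (logq q (jointSpectralRadius N A)))
    (h : (minpoly ℂ (sumMat A)).eval ((q : ℂ) ^ s) ≠ 0) (i j : Fin d) :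
    AnalyticAt ℂ (fun z => continuation hq A n₀ z i j) s := by
  simp only [continuation_apply]
  exact (((differentiable_natCast_cpow hq).analyticAt s).fun_div
    (analyticAt_eval_cpow hq _ s) h).fun_mul
    (analyticAt_divDiff_mul_inhomogeneity hN hq hn₀ hs i j)

/-- Factor the minimal polynomial as (X - λ)^k g with λ = q^s. Then (q^z - λ)^{-k} has order exactly
-k at s because q^z has nonzero derivative, and the cofactor is analytic. -/
theorem le_meromorphicOrderAt_continuation (hN : ∀ x : Fin d → ℂ, N x = 0 → x = 0)
    (hq : 2 ≤ q) (hn₀ : 1 ≤ n₀) {s : ℂ}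
    (hs : s ∈ halfPlane (logq q (jointSpectralRadius N A))) (i j : Fin d) :
    ((-((minpoly ℂ (sumMat A)).rootMultiplicity ((q : ℂ) ^ s) : ℤ) : ℤ) : WithTop ℤ)
      ≤ meromorphicOrderAt (fun z => continuation hq A n₀ z i j) s := by
  set lam := (q : ℂ) ^ s with hlam
  have hp : minpoly ℂ (sumMat A) ≠ 0 := minpoly.ne_zero (Matrix.isIntegral _)
  set k := (minpoly ℂ (sumMat A)).rootMultiplicity lam with hk
  obtain ⟨g, hg, hdvd⟩ := exists_eq_pow_rootMultiplicity_mul_and_not_dvd _ hp lam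
  rw [← hk] at hg
  have hg0 : g.eval ((q : ℂ) ^ s) ≠ 0 := fun h => hdvd (dvd_iff_isRoot.2 h)
  have han := (((differentiable_natCast_cpow hq).analyticAt s).fun_div
    (analyticAt_eval_cpow hq g s) hg0).fun_mul
    (analyticAt_divDiff_mul_inhomogeneity hN hq hn₀ hs i j)
  have hpow : meromorphicOrderAt ((fun z : ℂ => (z - lam) ^ (-k : ℤ)) ∘ fun z : ℂ => (q : ℂ) ^ z) s
      = ((-k : ℤ) : WithTop ℤ) := by
    rw [meromorphicOrderAt_comp_of_deriv_ne_zero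
      ((differentiable_natCast_cpow hq).analyticAt s) (deriv_natCast_cpow_ne_zero hq s)]
    exact meromorphicOrderAt_zpow_id_sub_const
  have hmer : MeromorphicAt ((fun z : ℂ => (z - lam) ^ (-k : ℤ)) ∘ fun z : ℂ => (q : ℂ) ^ z) s := by
    have : MeromorphicAt (fun z : ℂ => (q : ℂ) ^ z - lam) s :=
      (((differentiable_natCast_cpow hq).sub_const lam).analyticAt s).meromorphicAt
    exact this.fun_zpow _
  have heq : (fun z => continuation hq A n₀ z i j)
      = ((fun z : ℂ => (z - lam) ^ (-k : ℤ)) ∘ fun z : ℂ => (q : ℂ) ^ z)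
        * fun z => (q : ℂ) ^ z / g.eval ((q : ℂ) ^ z) *
          (divDiff (sumMat A) (minpoly ℂ (sumMat A)) ((q : ℂ) ^ z)
            * inhomogeneity hq A n₀ z) i j := by
    funext z
    have h1 : (minpoly ℂ (sumMat A)).eval ((q : ℂ) ^ z)
        = ((q : ℂ) ^ z - lam) ^ k * g.eval ((q : ℂ) ^ z) := by
      rw [hg]; simp
    rw [continuation_apply, h1]
    simp only [Pi.mul_apply, Function.comp_apply, _root_.zpow_neg, zpow_natCast]
    rw [div_mul_eq_div_div]
    ring
  rw [heq, meromorphicOrderAt_mul hmer han.meromorphicAt, hpow]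
  exact le_add_of_nonneg_right han.meromorphicOrderAt_nonneg

end Continuation

/-! ### Growth in the vertical direction. -/

section Growth

/-- Interpolates between the linear bound for |w| ≤ 1 and the trivial bound 1 + E for |w| ≥ 1. -/
theorem norm_exp_sub_one_le_mul_rpow {w : ℂ} {E μ : ℝ} (hE : Real.exp w.re ≤ E) (hμ₀ : 0 ≤ μ)
    (hμ₁ : μ ≤ 1) : ‖Complex.exp w - 1‖ ≤ (2 + E) * ‖w‖ ^ μ := by
  have hE0 : 0 < E := (Real.exp_pos _).trans_le hE
  rcases le_total ‖w‖ 1 with h | h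
  · have h1 : ‖w‖ ≤ ‖w‖ ^ μ := by
      rcases (norm_nonneg w).eq_or_lt with h0 | h0
      · rw [← h0]; exact Real.rpow_nonneg le_rfl _
      · simpa using Real.rpow_le_rpow_of_exponent_ge h0 h hμ₁
    calc ‖Complex.exp w - 1‖ ≤ 2 * ‖w‖ := Complex.norm_exp_sub_one_le h
      _ ≤ (2 + E) * ‖w‖ ^ μ := by gcongr; linarith
  · calc ‖Complex.exp w - 1‖ ≤ ‖Complex.exp w‖ + ‖(1 : ℂ)‖ := norm_sub_le _ _
      _ ≤ (2 + E) * 1 := by rw [Complex.norm_exp, norm_one]; linarith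
      _ ≤ (2 + E) * ‖w‖ ^ μ := by gcongr; exact Real.one_le_rpow h hμ₀

theorem norm_one_add_cpow_neg_sub_one_le {x S μ : ℝ} (hx₀ : 0 ≤ x) (hx₁ : x ≤ 1) {s : ℂ}
    (hS : |s.re| ≤ S) (hμ₀ : 0 ≤ μ) (hμ₁ : μ ≤ 1) :
    ‖(1 + (x : ℂ)) ^ (-s) - 1‖
      ≤ (2 + Real.exp S) * (S + 1) * max 1 |s.im| ^ μ * x ^ μ := by
  have hS0 : 0 ≤ S := (abs_nonneg _).trans hS
  have hlog₀ : 0 ≤ Real.log (1 + x) := Real.log_nonneg (by linarith)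
  have hlog₁ : Real.log (1 + x) ≤ x := by
    have := Real.log_le_sub_one_of_pos (by linarith : 0 < 1 + x)
    linarith
  have hm : (1 : ℝ) ≤ max 1 |s.im| := le_max_left _ _
  have hcast : (1 + (x : ℂ)) = ((1 + x : ℝ) : ℂ) := by push_cast; rfl
  have hne : (1 + (x : ℂ)) ≠ 0 := by
    rw [hcast]; exact_mod_cast (by linarith : (1 + x : ℝ) ≠ 0)
  rw [Complex.cpow_def_of_ne_zero hne, hcast, ← Complex.ofReal_log (by linarith)]
  have hre : Real.exp ((Real.log (1 + x) : ℂ) * -s).re ≤ Real.exp S := by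
    rw [Complex.re_ofReal_mul, Complex.neg_re]
    refine Real.exp_le_exp.2 ?_
    calc Real.log (1 + x) * -s.re ≤ Real.log (1 + x) * S := by
          gcongr
          exact (neg_le_abs _).trans hS
      _ ≤ 1 * S := by gcongr; linarith
      _ = S := one_mul S
  refine (norm_exp_sub_one_le_mul_rpow hre hμ₀ hμ₁).trans ?_
  -- The exponent w = -s log(1 + x) is linear in both x and the height, so |w|^μ distributes the
  -- same power to each.
  have hw : ‖(Real.log (1 + x) : ℂ) * -s‖ ≤ (S + 1) * max 1 |s.im| * x := by
    rw [norm_mul, norm_neg, Complex.norm_real, Real.norm_of_nonneg hlog₀, mul_comm]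
    have hs : ‖s‖ ≤ (S + 1) * max 1 |s.im| :=
      calc ‖s‖ ≤ |s.re| + |s.im| := Complex.norm_le_abs_re_add_abs_im s
        _ ≤ S * max 1 |s.im| + max 1 |s.im| :=
          add_le_add (hS.trans (le_mul_of_one_le_right hS0 hm)) (le_max_right _ _)
        _ = _ := by ring
    gcongr
  calc (2 + Real.exp S) * ‖(Real.log (1 + x) : ℂ) * -s‖ ^ μ
      ≤ (2 + Real.exp S) * ((S + 1) * max 1 |s.im| * x) ^ μ := by gcongr
    _ = (2 + Real.exp S) * ((S + 1) ^ μ * max 1 |s.im| ^ μ * x ^ μ) := by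
      rw [Real.mul_rpow (by positivity) hx₀, Real.mul_rpow (by positivity) (by positivity)]
    _ ≤ (2 + Real.exp S) * ((S + 1) * max 1 |s.im| ^ μ * x ^ μ) := by
      gcongr
      simpa using Real.rpow_le_rpow_of_exponent_le (by linarith : 1 ≤ S + 1) hμ₁
    _ = _ := by ring

theorem norm_shiftDiff_le {q r n : ℕ} (hr : r < q) (hn : 1 ≤ n) {S μ : ℝ} {s : ℂ}
    (hS : |s.re| ≤ S) (hμ₀ : 0 ≤ μ) (hμ₁ : μ ≤ 1) :
    ‖shiftDiff q r n s‖ ≤ (q : ℝ) ^ S * ((2 + Real.exp S) * (S + 1)) * max 1 |s.im| ^ μ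
      * (n : ℝ) ^ (-s.re - μ) := by
  have hq1 : (1 : ℝ) ≤ q := by exact_mod_cast (by omega : 1 ≤ q)
  have hn1 : (1 : ℝ) ≤ n := by exact_mod_cast hn
  have hr1 : (r : ℝ) ≤ q := by exact_mod_cast hr.le
  have hS0 : 0 ≤ S := (abs_nonneg _).trans hS
  have hx : (r : ℝ) / q / n ≤ (n : ℝ)⁻¹ := by
    rw [div_eq_mul_inv]
    refine mul_le_of_le_one_left (by positivity) ((div_le_one (by linarith)).2 hr1)
  have hx1 : (r : ℝ) / q / n ≤ 1 := hx.trans (inv_le_one_of_one_le₀ hn1)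
  have h := norm_one_add_cpow_neg_sub_one_le (by positivity) hx1 hS hμ₀ hμ₁
  rw [shiftDiff_eq (by omega) hn, norm_mul, norm_mul, norm_natCast_cpow_neg (by omega),
    norm_natCast_cpow_neg hn]
  push_cast at h
  calc (q : ℝ) ^ (-s.re) * ((n : ℝ) ^ (-s.re) * ‖(1 + (r : ℂ) / q / n) ^ (-s) - 1‖)
      ≤ (q : ℝ) ^ S * ((n : ℝ) ^ (-s.re) * ((2 + Real.exp S) * (S + 1) * max 1 |s.im| ^ μ
        * ((r : ℝ) / q / n) ^ μ)) := by
        gcongr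
        exact (neg_le_abs _).trans hS
    _ ≤ (q : ℝ) ^ S * ((n : ℝ) ^ (-s.re) * ((2 + Real.exp S) * (S + 1) * max 1 |s.im| ^ μ
        * ((n : ℝ)⁻¹) ^ μ)) := by gcongr
    _ = _ := by
      rw [sub_eq_add_neg, Real.rpow_add (by linarith), Real.inv_rpow (by linarith),
        ← Real.rpow_neg (by linarith)]
      ring

variable {q d : ℕ} {N : Seminorm ℂ (Fin d → ℂ)} {A : Fin q → Mat d} {n₀ : ℕ}

/-- With μ = 1 - (Re s - b), which lies in [0, 1] on the strip, the exponent -Re s - μ is the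
constant -b - 1. Together with f(n) = O(n^β), β < b, one convergent majorant serves the whole strip.
-/
theorem exists_norm_inhomogeneity_le (hN : ∀ x : Fin d → ℂ, N x = 0 → x = 0) (hq : 2 ≤ q)
    (hn₀ : 1 ≤ n₀) {b : ℝ} (hb : logq q (jointSpectralRadius N A) < b) :
    ∃ K : ℝ, 0 ≤ K ∧ ∀ s : ℂ, b ≤ s.re → s.re ≤ b + 1 →
      ‖inhomogeneity hq A n₀ s‖ ≤ K * max 1 |s.im| ^ (1 - (s.re - b)) := by
  obtain ⟨β, K, -, hβ, hK, hf⟩ := exists_norm_matSeq_le_of_logq_lt (A := A) hN hq hb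
  set S := |b| + 1 with hS
  set D := (q : ℝ) ^ S * ((2 + Real.exp S) * (S + 1)) with hD
  have hD0 : 0 ≤ D := by positivity
  have hu : Summable fun n : Set.Ici n₀ => K * ((n : ℕ) : ℝ) ^ (β - b - 1) :=
    (summable_natCast_rpow_Ici (by linarith) n₀).mul_left K
  set U := ∑' n : Set.Ici n₀, K * ((n : ℕ) : ℝ) ^ (β - b - 1) with hU
  have hU0 : 0 ≤ U := tsum_nonneg fun n => by positivity
  refine ⟨∑ n ∈ Finset.Ico n₀ (q * n₀), K * (n : ℝ) ^ (β - b)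
    + ∑ r : Fin q, d * ‖A r‖ * (D * U), by positivity, fun s hs₁ hs₂ => ?_⟩
  have hsre : |s.re| ≤ S := by
    rw [abs_le]
    have := neg_abs_le b
    have := le_abs_self b
    constructor <;> linarith
  set μ := 1 - (s.re - b) with hμ
  set m := max 1 |s.im| ^ μ with hm
  have hm1 : 1 ≤ m := Real.one_le_rpow (le_max_left _ _) (by linarith)
  have hmem : s ∈ halfPlane (logq q (jointSpectralRadius N A)) :=
    lt_of_lt_of_le hb (by exact_mod_cast hs₁)
  rw [inhomogeneity_eq hN hq hn₀ hmem, add_mul, Finset.sum_mul, Finset.sum_mul]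
  refine (norm_add_le _ _).trans (add_le_add ((norm_sum_le _ _).trans
    (Finset.sum_le_sum fun n hn => ?_)) ((norm_sum_le _ _).trans
    (Finset.sum_le_sum fun r _ => ?_)))
  · exact (norm_dirichletTerm_le hq hf (hn₀.trans (Finset.mem_Ico.1 hn).1) hs₁).trans
      (le_mul_of_one_le_right (by positivity) hm1)
  · have h1 : ‖∑' n : Set.Ici n₀, shiftDiff q r n s • matSeq hq A n‖ ≤ D * m * U := by
      refine tsum_of_norm_bounded (hu.hasSum.mul_left (D * m)) fun n => ?_
      have hn : 1 ≤ (n : ℕ) := hn₀.trans n.2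
      have hn0 : (0 : ℝ) < (n : ℕ) := by exact_mod_cast hn
      rw [norm_smul]
      calc ‖shiftDiff q r n s‖ * ‖matSeq hq A n‖
          ≤ D * m * ((n : ℕ) : ℝ) ^ (-s.re - μ) * (K * ((n : ℕ) : ℝ) ^ β) := by
            refine mul_le_mul (norm_shiftDiff_le r.2 hn hsre (by linarith) (by linarith))
              (hf n hn) (norm_nonneg _) (by positivity)
        _ = D * m * (K * (((n : ℕ) : ℝ) ^ (-s.re - μ) * ((n : ℕ) : ℝ) ^ β)) := by ring
        _ = _ := by rw [← Real.rpow_add hn0]; congr 3; rw [hμ]; ring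
    calc ‖A r * ∑' n : Set.Ici n₀, shiftDiff q r n s • matSeq hq A n‖
        ≤ d * ‖A r‖ * ‖∑' n : Set.Ici n₀, shiftDiff q r n s • matSeq hq A n‖ :=
          norm_matrix_mul_le _ _
      _ ≤ d * ‖A r‖ * (D * m * U) := by gcongr
      _ = _ := by ring

/-- Roots of the minimal polynomial are eigenvalues, so the quotient is continuous on the compact
set left after removing the δ-disks. -/
theorem exists_norm_scaledResolvent_le (C : Mat d) {δ : ℝ} (hδ : 0 < δ) (B : ℝ) :
    ∃ K : ℝ, 0 ≤ K ∧ ∀ μ : ℂ, ‖μ‖ ≤ B → (∀ lam ∈ spectrum ℂ C, δ ≤ ‖μ - lam‖) →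
      ‖scaledResolvent C μ‖ ≤ K := by
  have hc : IsCompact (Metric.closedBall (0 : ℂ) B ∩
      ⋂ lam ∈ spectrum ℂ C, {μ : ℂ | δ ≤ ‖μ - lam‖}) := by
    refine (isCompact_closedBall _ _).inter_right (isClosed_biInter fun lam _ => ?_)
    exact isClosed_le continuous_const (by fun_prop)
  have hcont : ContinuousOn (scaledResolvent C) (Metric.closedBall (0 : ℂ) B ∩
      ⋂ lam ∈ spectrum ℂ C, {μ : ℂ | δ ≤ ‖μ - lam‖}) := by
    refine ContinuousOn.smul (continuousOn_id.div (Polynomial.continuous _).continuousOn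
      fun μ hμ h0 => ?_) (differentiable_divDiff C _).continuous.continuousOn
    have h1 := Set.mem_iInter₂.1 hμ.2 μ (mem_spectrum_of_eval_minpoly_eq_zero h0)
    simp at h1
    linarith
  obtain ⟨K, hK⟩ := hc.exists_bound_of_continuousOn hcont
  exact ⟨max K 0, le_max_right _ _, fun μ h1 h2 => (hK μ ⟨by simpa using h1,
    Set.mem_iInter₂.2 h2⟩).trans (le_max_left _ _)⟩

theorem muDelta_bot (δ z : ℝ) : muDelta ⊥ δ z = 0 := by
  simp [muDelta]

theorem muDelta_coe (α δ z : ℝ) : muDelta (α : EReal) δ z = max (1 - (z - α - δ)) 0 := by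
  rw [muDelta, ← EReal.coe_sub, ← EReal.coe_sub, ← EReal.coe_one, ← EReal.coe_sub,
    ← EReal.coe_zero, ← EReal.coe_strictMono.monotone.map_max, EReal.toReal_coe]

/-- If ρ = 0, all eigenvalues of C are 0, and one exists since d ≥ 1. Staying δ away from it forces
Re s ≥ log_q δ, where the series is uniformly bounded. -/
theorem continuation_bounded_of_radius_eq_zero (hN : ∀ x : Fin d → ℂ, N x = 0 → x = 0)
    (hq : 2 ≤ q) (hd : 1 ≤ d) (hn₀ : 1 ≤ n₀) (h0 : jointSpectralRadius N A = 0) {δ : ℝ}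
    (hδ : 0 < δ) :
    ∃ K : ℝ, ∀ s : ℂ, (∀ lam ∈ spectrum ℂ (sumMat A), δ ≤ ‖(q : ℂ) ^ s - lam‖) →
      opNorm N (continuation hq A n₀ s) ≤ K := by
  have hbot : logq q (jointSpectralRadius N A) = ⊥ := by rw [h0, logq, if_pos rfl]
  have hq1 : (1 : ℝ) < q := by exact_mod_cast (by omega : 1 < q)
  have : Nonempty (Fin d) := ⟨⟨0, hd⟩⟩
  have hspec : (0 : ℂ) ∈ spectrum ℂ (sumMat A) := by
    obtain ⟨lam, hlam⟩ := spectrum.nonempty_of_isAlgClosed_of_finiteDimensional ℂ (sumMat A)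
    have h1 : ‖lam‖ ≤ 0 := le_of_forall_pos_le_add fun ε hε => by
      have := norm_le_of_mem_spectrum_sumMat (R := ε / q) hN (by rw [h0]; positivity) hlam
      rwa [mul_div_cancel₀ _ (by positivity), ← zero_add ε] at this
    rwa [norm_le_zero_iff.1 h1] at hlam
  set b := Real.logb q δ with hb
  obtain ⟨β, K, -, hβ, -, hf⟩ := exists_norm_matSeq_le_of_logq_lt (A := A) (b := b - 1) hN hq
    (by rw [hbot]; exact EReal.bot_lt_coe _)
  obtain ⟨B, hB, hFB⟩ := exists_norm_dirichletSeries_le hq hf hn₀ (b := b) (by linarith)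
  obtain ⟨c, hc, hcM⟩ := exists_opNorm_equiv hN
  refine ⟨c * B, fun s hs => ?_⟩
  have hsb : b ≤ s.re := by
    have h1 := hs 0 hspec
    rw [sub_zero, Complex.norm_natCast_cpow_of_pos (by omega)] at h1
    exact (Real.logb_le_iff_le_rpow hq1 hδ).2 h1
  have hmem : s ∈ halfPlane (logq q (jointSpectralRadius N A) + 1) := by
    rw [hbot]; exact EReal.bot_lt_coe _
  rw [continuation_eq hN hq hn₀ hmem]
  exact (hcM _).1.trans (by gcongr; exact hFB s hsb)

theorem exists_opNorm_continuation_le (hN : ∀ x : Fin d → ℂ, N x = 0 → x = 0)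
    (hq : 2 ≤ q) (hd : 1 ≤ d) (hn₀ : 1 ≤ n₀) {δ : ℝ} (hδ : 0 < δ) :
    ∃ K : ℝ, ∀ s : ℂ, logq q (jointSpectralRadius N A) + (δ : EReal) ≤ ((s.re : ℝ) : EReal) →
      (∀ lam ∈ spectrum ℂ (sumMat A), δ ≤ ‖(q : ℂ) ^ s - lam‖) →
        opNorm N (continuation hq A n₀ s)
          ≤ K * max 1 |s.im| ^ muDelta (logq q (jointSpectralRadius N A)) δ s.re := by
  by_cases h0 : jointSpectralRadius N A = 0
  · obtain ⟨K, hK⟩ := continuation_bounded_of_radius_eq_zero hN hq hd hn₀ h0 hδ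
    refine ⟨K, fun s _ hs => ?_⟩
    rw [logq, if_pos h0, muDelta_bot, Real.rpow_zero, mul_one]
    exact hK s hs
  have hq1 : (1 : ℝ) < q := by exact_mod_cast (by omega : 1 < q)
  set α := Real.logb q (jointSpectralRadius N A)
  have hα : logq q (jointSpectralRadius N A) = α := by rw [logq, if_neg h0]
  have hαδ : logq q (jointSpectralRadius N A) < ((α + δ : ℝ) : EReal) := by
    rw [hα]; exact_mod_cast (by linarith : α < α + δ)
  obtain ⟨β, K, -, hβ, -, hf⟩ := exists_norm_matSeq_le_of_logq_lt (A := A) hN hq hαδ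
  obtain ⟨B, hB, hFB⟩ := exists_norm_dirichletSeries_le hq hf hn₀ (b := α + δ + 1) (by linarith)
  obtain ⟨K₁, hK₁, hG⟩ := exists_norm_inhomogeneity_le (A := A) hN hq hn₀ hαδ
  obtain ⟨K₂, hK₂, hR⟩ := exists_norm_scaledResolvent_le (sumMat A) hδ ((q : ℝ) ^ (α + δ + 1))
  obtain ⟨c, hc, hcM⟩ := exists_opNorm_equiv hN
  refine ⟨c * (B + d * K₂ * K₁), fun s hs hspec => ?_⟩
  have hs' : α + δ ≤ s.re := by rw [hα] at hs; exact_mod_cast hs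
  rw [hα, muDelta_coe]
  set m := max 1 |s.im| ^ max (1 - (s.re - α - δ)) 0 with hm
  have hm1 : 1 ≤ m := Real.one_le_rpow (le_max_left _ _) (le_max_right _ _)
  refine (hcM _).1.trans ?_
  rw [mul_assoc]
  gcongr
  -- Right of the strip the Dirichlet series itself is bounded; inside it, the resolvent bound is
  -- combined with the bound for G.
  rcases le_total (α + δ + 1) s.re with h | h
  · have hmem : s ∈ halfPlane (logq q (jointSpectralRadius N A) + 1) := by
      change logq q (jointSpectralRadius N A) + 1 < ((s.re : ℝ) : EReal)
      rw [hα]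
      exact_mod_cast (by linarith : α + 1 < s.re)
    rw [continuation_eq hN hq hn₀ hmem]
    calc ‖dirichletSeries hq A n₀ s‖ ≤ B := hFB s h
      _ ≤ B + d * K₂ * K₁ := le_add_of_nonneg_right (by positivity)
      _ ≤ _ := le_mul_of_one_le_right (by positivity) hm1
  · have hmu : max (1 - (s.re - α - δ)) 0 = 1 - (s.re - (α + δ)) := by
      rw [max_eq_left (by linarith)]; ring
    have h1 := hG s hs' h
    rw [← hmu] at h1
    have h2 := hR ((q : ℂ) ^ s) (by
      rw [Complex.norm_natCast_cpow_of_pos (by omega)]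
      exact Real.rpow_le_rpow_of_exponent_le hq1.le h) hspec
    calc ‖continuation hq A n₀ s‖
        ≤ d * ‖scaledResolvent (sumMat A) ((q : ℂ) ^ s)‖ * ‖inhomogeneity hq A n₀ s‖ :=
          norm_matrix_mul_le _ _
      _ ≤ d * K₂ * (K₁ * m) := by gcongr
      _ = d * K₂ * K₁ * m := by ring
      _ ≤ (B + d * K₂ * K₁) * m := by gcongr; linarith

end Growth

end RegDirichlet

end

theorem theorem5p3 (q d : ℕ) (hq : 2 ≤ q) (hd : 1 ≤ d)
    (N : Seminorm ℂ (Fin d → ℂ)) (hN : ∀ x : Fin d → ℂ, N x = 0 → x = 0)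
    (A : Fin q → RegDirichlet.Mat d)
    (C : RegDirichlet.Mat d) (hC : C = RegDirichlet.sumMat A)
    (ρ : ℝ) (hρ : ρ = RegDirichlet.jointSpectralRadius N A)
    (a : EReal) (ha : a = RegDirichlet.logq q ρ)
    (n₀ : ℕ) (hn₀ : 1 ≤ n₀) :
    -- absolute and locally uniform convergence, analyticity for `Re s > log_q ρ + 1`
    RegDirichlet.ConvergesAbsUnifOnCompacts N
      (fun (n : Set.Ici n₀) s => RegDirichlet.dirichletTerm hq A n s)
      (RegDirichlet.halfPlane (a + 1)) ∧
    (∀ i j : Fin d, AnalyticOnNhd ℂ (fun s => RegDirichlet.dirichletSeries hq A n₀ s i j)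
      (RegDirichlet.halfPlane (a + 1))) ∧
    -- the functional equation for `Re s > log_q ρ + 1`
    (∀ s ∈ RegDirichlet.halfPlane (a + 1),
      (1 - (q : ℂ) ^ (-s) • C) * RegDirichlet.dirichletSeries hq A n₀ s
        = RegDirichlet.inhomogeneity hq A n₀ s) ∧
    -- convergence of the series over `k` for `Re s > log_q ρ`
    (∀ r : Fin q, RegDirichlet.ConvergesAbsUnifOnCompacts N
      (fun (k : Set.Ici 1) s => RegDirichlet.binomTerm hq A n₀ r k s)
      (RegDirichlet.halfPlane a)) ∧
    -- the meromorphic continuation `Φ`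
    ∃ Φ : ℂ → RegDirichlet.Mat d,
      (∀ s ∈ RegDirichlet.halfPlane (a + 1), Φ s = RegDirichlet.dirichletSeries hq A n₀ s) ∧
      (∀ i j : Fin d, MeromorphicOn (fun s => Φ s i j) (RegDirichlet.halfPlane a)) ∧
      -- outside the possible poles, `Φ` is analytic and satisfies the functional equation
      (∀ s ∈ RegDirichlet.halfPlane a,
        (∀ lam ∈ spectrum ℂ C, ρ < ‖lam‖ → ∀ l : ℤ, s ≠ RegDirichlet.polePoint q lam l) →
          (∀ i j : Fin d, AnalyticAt ℂ (fun z => Φ z i j) s) ∧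
          (1 - (q : ℂ) ^ (-s) • C) * Φ s = RegDirichlet.inhomogeneity hq A n₀ s) ∧
      -- the pole orders
      (∀ lam ∈ spectrum ℂ C, ρ < ‖lam‖ → ∀ (l : ℤ) (i j : Fin d),
        ((-(RegDirichlet.maxJordanSize C lam : ℤ) : ℤ) : WithTop ℤ)
          ≤ meromorphicOrderAt (fun z => Φ z i j) (RegDirichlet.polePoint q lam l)) ∧
      -- the growth in vertical direction
      (∀ δ : ℝ, 0 < δ → ∃ K : ℝ, ∀ s : ℂ,
        a + (δ : EReal) ≤ ((s.re : ℝ) : EReal) →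
        (∀ lam ∈ spectrum ℂ C, δ ≤ ‖(q : ℂ) ^ s - lam‖) →
          RegDirichlet.opNorm N (Φ s)
            ≤ K * max 1 |s.im| ^ RegDirichlet.muDelta a δ s.re) := by
  subst hC hρ ha
  have hρ0 := RegDirichlet.jointSpectralRadius_nonneg (N := N) (A := A)
  refine ⟨(RegDirichlet.dirichletTerm_locallyDominated hN hq hn₀).convergesAbsUnifOnCompacts hN,
    RegDirichlet.analyticOnNhd_entry (RegDirichlet.differentiableOn_dirichletSeries hN hq hn₀),
    fun s hs => RegDirichlet.functional_equation hN hq hn₀ hs,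
    fun r => (RegDirichlet.binomTerm_locallyDominated hN hq hn₀ r).convergesAbsUnifOnCompacts hN,
    RegDirichlet.continuation hq A n₀,
    fun s hs => RegDirichlet.continuation_eq hN hq hn₀ hs,
    fun i j s hs => RegDirichlet.meromorphicAt_continuation hN hq hn₀ hs i j,
    fun s hs hpole => ?_, fun lam _ hlam l i j => ?_,
    fun δ hδ => RegDirichlet.exists_opNorm_continuation_le hN hq hd hn₀ hδ⟩
  -- If q^s were a root, it would be an eigenvalue of modulus q^{Re s} > ρ, and s, a logarithm of it
  -- to base q, would be one of the excluded points.
  · have hne : (minpoly ℂ (RegDirichlet.sumMat A)).eval ((q : ℂ) ^ s) ≠ 0 := fun h => by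
      obtain ⟨l, hl⟩ := RegDirichlet.eq_polePoint hq s
      exact hpole _ (RegDirichlet.mem_spectrum_of_eval_minpoly_eq_zero h)
        (RegDirichlet.lt_norm_cpow hq hρ0 hs) l hl
    exact ⟨RegDirichlet.analyticAt_continuation hN hq hn₀ hs hne,
      RegDirichlet.sub_mul_continuation hq hne⟩
  · have h := RegDirichlet.le_meromorphicOrderAt_continuation (A := A) hN hq hn₀
      (RegDirichlet.polePoint_mem_halfPlane hq hρ0 hlam l) i j
    rw [RegDirichlet.cpow_polePoint hq (norm_pos_iff.1 (hρ0.trans_lt hlam)) l] at h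
    refine le_trans ?_ h
    have := RegDirichlet.rootMultiplicity_le_maxJordanSize (RegDirichlet.sumMat A) lam
    exact_mod_cast neg_le_neg (by exact_mod_cast this)
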